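/- An instance of the problem consists of a finite set $\mathcal{D}$ of convex polygons (each given by the list of its vertices in counterclockwise order), a finite set $P$ of points in the plane, all coordinates being integers, and a positive integer $k$; the question is whether there are $k$ polygons in $\mathcal{D}$ that together cover $P$. Running times are measured on a random access machine with logarithmic cost. The Strong Exponential Time Hypothesis (SETH) states that for no $\epsilon>0$ there is an algorithm that decides the satisfiability of CNF formulas $\varphi$ with $n$ variables in time $(2-\epsilon)^n\cdot|\varphi|^{O(1)}$. Assume SETH. Then there is no algorithm that decides this problem in time $f(k)\cdot(|\mathcal{D}|+|P|)^{k-\epsilon}$ for any computable function $f$ and any $\epsilon>0$. Moreover, for every fixed integer $k\ge 3$ and every $\epsilon>0$, no algorithm decides the problem for this $k$ in time $O\big((|\mathcal{D}|+|P|)^{k-\epsilon}\big)$, not even if it is required to be correct and fast only on the instances with $|\mathcal{D}|+|P|\ge 1$ in which every polygon has at most $|\mathcal{D}|+|P|$ vertices and all coordinates are at most $(|\mathcal{D}|+|P|)^2$ in absolute value. -/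

import Mathlib

/-! ### Machine model: a random access machine with logarithmic cost

A machine has finitely many integer arrays (the ones its program mentions), each with random access,
and a structured program. Every arithmetic operation and every memory access is charged
the bit lengths of all numbers that occur in it, including addresses and results. -/

namespace RAM

/-- The memory: `s x i` is the content of cell `i` of array `x`. -/
abbrev Store := ℕ → ℤ → ℤ

/-- Arithmetic expressions; `get x i` reads cell `i` of array `x`. -/
inductive Expr where
  | const (c : ℤ)
  | get (x : ℕ) (i : Expr)
  | add (a b : Expr)
  | sub (a b : Expr)
  | mul (a b : Expr)
  | div (a b : Expr)

/-- The value of an expression (`div` is integer division). -/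
def Expr.eval (s : Store) : Expr → ℤ
  | .const c => c
  | .get x i => s x (i.eval s)
  | .add a b => a.eval s + b.eval s
  | .sub a b => a.eval s - b.eval s
  | .mul a b => a.eval s * b.eval s
  | .div a b => a.eval s / b.eval s

/-- The cost of handling one integer: one plus its bit length. -/
def intCost (z : ℤ) : ℕ := z.natAbs.size + 1

/-- The logarithmic cost of evaluating an expression: every intermediate value is charged. -/
def Expr.cost (s : Store) : Expr → ℕ
  | .const c => intCost c
  | .get x i => i.cost s + intCost ((Expr.get x i).eval s)
  | .add a b => a.cost s + b.cost s + intCost ((Expr.add a b).eval s)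
  | .sub a b => a.cost s + b.cost s + intCost ((Expr.sub a b).eval s)
  | .mul a b => a.cost s + b.cost s + intCost ((Expr.mul a b).eval s)
  | .div a b => a.cost s + b.cost s + intCost ((Expr.div a b).eval s)

/-- Programs. `assign x i e` writes the value of `e` to cell `i` of array `x`; the tests of `ite`
and `loop` succeed when the value of the expression is positive. -/
inductive Prog where
  | skip
  | assign (x : ℕ) (i e : Expr)
  | seq (p q : Prog)
  | ite (e : Expr) (p q : Prog)
  | loop (e : Expr) (p : Prog)

/-- `Exec p s t s'`: started on memory `s`, the program `p` halts with memory `s'` and total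
cost `t`. -/
inductive Exec : Prog → Store → ℕ → Store → Prop where
  | skip (s : Store) : Exec .skip s 1 s
  | assign (x : ℕ) (i e : Expr) (s : Store) :
      Exec (.assign x i e) s (i.cost s + e.cost s + 1)
        (Function.update s x (Function.update (s x) (i.eval s) (e.eval s)))
  | seq {p q : Prog} {s s' s'' : Store} {t u : ℕ} :
      Exec p s t s' → Exec q s' u s'' → Exec (.seq p q) s (t + u) s''
  | iteTrue {e : Expr} {p q : Prog} {s s' : Store} {t : ℕ} :
      0 < e.eval s → Exec p s t s' → Exec (.ite e p q) s (e.cost s + 1 + t) s'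
  | iteFalse {e : Expr} {p q : Prog} {s s' : Store} {t : ℕ} :
      ¬ 0 < e.eval s → Exec q s t s' → Exec (.ite e p q) s (e.cost s + 1 + t) s'
  | loopDone {e : Expr} {p : Prog} {s : Store} :
      ¬ 0 < e.eval s → Exec (.loop e p) s (e.cost s + 1) s
  | loopStep {e : Expr} {p : Prog} {s s' s'' : Store} {t u : ℕ} :
      0 < e.eval s → Exec p s t s' → Exec (.loop e p) s' u s'' →
      Exec (.loop e p) s (e.cost s + 1 + t + u) s''

/-- The initial memory on input `w`: the input is in cells `0, 1, …` of array `0`, every other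
cell holds `0`. -/
def start (w : List ℤ) : Store := fun x i =>
  if x = 0 ∧ 0 ≤ i then w.getD i.toNat 0 else 0

/-- On input `w` the program halts within cost `T`, and it accepts (leaves a nonzero number in
cell `0` of array `1`) exactly if `answer` holds. -/
def DecidesWithin (p : Prog) (w : List ℤ) (answer : Prop) (T : ℝ) : Prop :=
  ∃ (t : ℕ) (s : Store), Exec p (start w) t s ∧ (t : ℝ) ≤ T ∧ (s 1 0 ≠ 0 ↔ answer)

end RAM

/-! ### CNF satisfiability and the Strong Exponential Time Hypothesis -/

/-- A formula in conjunctive normal form: a list of clauses, which are lists of literals; the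
literal `(v, b)` is true when the variable `v` has the value `b`. -/
structure CNF where
  numVars : ℕ
  clauses : List (List (Fin numVars × Bool))

namespace CNF

def Satisfiable (φ : CNF) : Prop :=
  ∃ a : Fin φ.numVars → Bool, ∀ c ∈ φ.clauses, ∃ l ∈ c, a l.1 = l.2

/-- Number of variables plus number of clauses plus number of literal occurrences. -/
def size (φ : CNF) : ℕ :=
  φ.numVars + (φ.clauses.map fun c => c.length + 1).sum

/-- The literals of variable number `v` are written as `v + 1` and `-(v + 1)`. -/
def encodeLiteral {n : ℕ} (l : Fin n × Bool) : ℤ :=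
  if l.2 then ((l.1 : ℕ) : ℤ) + 1 else -(((l.1 : ℕ) : ℤ) + 1)

/-- The number of variables, the number of clauses, and the clauses, each preceded by its length. -/
def encode (φ : CNF) : List ℤ :=
  (φ.numVars : ℤ) :: (φ.clauses.length : ℤ) ::
    φ.clauses.flatMap fun c => (c.length : ℤ) :: c.map encodeLiteral

end CNF

/-- SETH: for no `ε > 0` can the satisfiability of CNF formulas with `n` variables be decided in
time `(2 - ε)^n`, up to a factor polynomial in the size of the formula. -/
def SETH : Prop :=
  ∀ ε : ℝ, 0 < ε → ε < 1 → ¬ ∃ (A : RAM.Prog) (C : ℝ) (c : ℕ), ∀ φ : CNF,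
    RAM.DecidesWithin A φ.encode φ.Satisfiable
      (C * (2 - ε) ^ φ.numVars * ((φ.size : ℝ) + 1) ^ c)

/-! ### Covering points with convex polygons -/

/-- Twice the signed area of the triangle `a b c`; it is positive for a left turn. -/
def orient (a b c : ℤ × ℤ) : ℤ :=
  (b.1 - a.1) * (c.2 - a.2) - (b.2 - a.2) * (c.1 - a.1)

/-- `v` lists the vertices of a (nondegenerate) convex polygon in counterclockwise order, from an
arbitrary first vertex on. -/
def IsConvexPolygon (v : List (ℤ × ℤ)) : Prop :=
  3 ≤ v.length ∧
    ∀ i j l : Fin v.length, i < j → j < l → 0 < orient (v.get i) (v.get j) (v.get l)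

/-- A point with integer coordinates as a point of the real plane. -/
def toPlane (q : ℤ × ℤ) : ℝ × ℝ := ((q.1 : ℝ), (q.2 : ℝ))

/-- The region of the plane bounded by the convex polygon with vertices `v`, boundary included. -/
def region (v : List (ℤ × ℤ)) : Set (ℝ × ℝ) :=
  convexHull ℝ {p | ∃ q ∈ v, p = toPlane q}

/-- A finite set of convex polygons and a finite set of points in the plane, each in an arbitrary
order. -/
structure CoverInstance where
  polygons : List (List (ℤ × ℤ))
  points : List (ℤ × ℤ)
  convex : ∀ v ∈ polygons, IsConvexPolygon v
  polygons_distinct : polygons.Pairwise fun v w => region v ≠ region w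
  points_distinct : points.Nodup

namespace CoverInstance

/-- The number of polygons plus the number of points. -/
def card (I : CoverInstance) : ℕ := I.polygons.length + I.points.length

/-- There are `k` polygons that together cover all the points. -/
def HasCover (I : CoverInstance) (k : ℕ) : Prop :=
  ∃ S : Finset (Fin I.polygons.length), S.card = k ∧
    ∀ p ∈ I.points, ∃ i ∈ S, toPlane p ∈ region (I.polygons.get i)

/-- Every polygon has at most `n` vertices and all coordinates are at most `n ^ 2` in absolute
value, where `n` is the number of polygons and points. -/
def Compact (I : CoverInstance) : Prop :=
  (∀ v ∈ I.polygons, v.length ≤ I.card ∧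
    ∀ q ∈ v, |q.1| ≤ (I.card : ℤ) ^ 2 ∧ |q.2| ≤ (I.card : ℤ) ^ 2) ∧
  ∀ q ∈ I.points, |q.1| ≤ (I.card : ℤ) ^ 2 ∧ |q.2| ≤ (I.card : ℤ) ^ 2

/-- A list of points: its length, followed by the coordinates. -/
def encodePoints (v : List (ℤ × ℤ)) : List ℤ :=
  (v.length : ℤ) :: v.flatMap fun q => [q.1, q.2]

/-- The input for the question whether `k` polygons suffice: `k`, the number of polygons, the
polygons, and the points. -/
def encode (I : CoverInstance) (k : ℕ) : List ℤ :=
  (k : ℤ) :: (I.polygons.length : ℤ) :: I.polygons.flatMap encodePoints ++ encodePoints I.points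

end CoverInstance

/-!
Divide the variables of a formula into `k` groups and make every assignment of truth values to one
group into a polygon inscribed in the parabola `y = x ^ 2`. A polygon inscribed in a parabola
contains a point of the parabola only if it has this point as a vertex. So there is one point for
every clause, which is a vertex of exactly the polygons whose assignments satisfy the clause, and
one point for every group, which is a vertex of exactly the polygons that belong to this group;
`k` polygons that cover the latter points are one assignment for each group, hence an assignment
for the formula. There are about `k * 2 ^ (n / k)` polygons for `n` variables, so the excluded
running time would decide satisfiability in time `2 ^ (n * (k - ε) / k)`, up to a factor polynomial
in the size of the formula. The instance itself is written in time `2 ^ (n / k)` up to such a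
factor, which is shorter as soon as `2 ≤ k`.
-/

namespace RAM

section Renaming

/-- The expression obtained by replacing every array `x` with the array `ρ x`. -/
def Expr.rename (ρ : ℕ → ℕ) : Expr → Expr
  | .const a => .const a
  | .get x i => .get (ρ x) (i.rename ρ)
  | .add a b => .add (a.rename ρ) (b.rename ρ)
  | .sub a b => .sub (a.rename ρ) (b.rename ρ)
  | .mul a b => .mul (a.rename ρ) (b.rename ρ)
  | .div a b => .div (a.rename ρ) (b.rename ρ)

/-- The program obtained by replacing every array `x` with the array `ρ x`. -/
def Prog.rename (ρ : ℕ → ℕ) : Prog → Prog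
  | .skip => .skip
  | .assign x i e => .assign (ρ x) (i.rename ρ) (e.rename ρ)
  | .seq p q => .seq (p.rename ρ) (q.rename ρ)
  | .ite e p q => .ite (e.rename ρ) (p.rename ρ) (q.rename ρ)
  | .loop e p => .loop (e.rename ρ) (p.rename ρ)

variable {ρ : ℕ → ℕ} {r s : Store}

theorem Expr.eval_rename (h : ∀ x, r (ρ x) = s x) (e : Expr) :
    (e.rename ρ).eval r = e.eval s := by
  induction e <;> simp only [Expr.rename, Expr.eval, *]

theorem Expr.cost_rename (h : ∀ x, r (ρ x) = s x) (e : Expr) :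
    (e.rename ρ).cost r = e.cost s := by
  induction e <;> simp only [Expr.rename, Expr.cost, Expr.eval, Expr.eval_rename h, *]

theorem Exec.rename (hρ : ρ.Injective) {p : Prog} {s s' : Store} {t : ℕ} (hp : Exec p s t s') :
    ∀ r : Store, (∀ x, r (ρ x) = s x) →
      ∃ r', Exec (p.rename ρ) r t r' ∧ ∀ x, r' (ρ x) = s' x := by
  induction hp with
  | skip s => exact fun r h => ⟨r, .skip r, h⟩
  | assign x i e s =>
    intro r h
    rw [← Expr.cost_rename h, ← Expr.cost_rename h]
    refine ⟨_, .assign (ρ x) (i.rename ρ) (e.rename ρ) r, fun y => ?_⟩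
    obtain rfl | hy := eq_or_ne y x
    · simp [Expr.eval_rename h, h]
    · simp [hρ.ne hy, h, hy]
  | seq _ _ ih₁ ih₂ =>
    intro r h
    obtain ⟨r₁, h₁, e₁⟩ := ih₁ r h
    obtain ⟨r₂, h₂, e₂⟩ := ih₂ r₁ e₁
    exact ⟨r₂, .seq h₁ h₂, e₂⟩
  | iteTrue hc _ ih =>
    intro r h
    obtain ⟨r₁, h₁, e₁⟩ := ih r h
    rw [← Expr.eval_rename h] at hc
    rw [← Expr.cost_rename h]
    exact ⟨r₁, .iteTrue hc h₁, e₁⟩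
  | iteFalse hc _ ih =>
    intro r h
    obtain ⟨r₁, h₁, e₁⟩ := ih r h
    rw [← Expr.eval_rename h] at hc
    rw [← Expr.cost_rename h]
    exact ⟨r₁, .iteFalse hc h₁, e₁⟩
  | loopDone hc =>
    intro r h
    rw [← Expr.eval_rename h] at hc
    rw [← Expr.cost_rename h]
    exact ⟨r, .loopDone hc, h⟩
  | loopStep hc _ _ ih₁ ih₂ =>
    intro r h
    obtain ⟨r₁, h₁, e₁⟩ := ih₁ r h
    obtain ⟨r₂, h₂, e₂⟩ := ih₂ r₁ e₁
    rw [← Expr.eval_rename h] at hc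
    rw [← Expr.cost_rename h]
    exact ⟨r₂, .loopStep hc h₁ h₂, e₂⟩

theorem DecidesWithin.seq_rename {A p : Prog} {w w' : List ℤ} {answer : Prop} {t : ℕ} {T : ℝ}
    (hA : DecidesWithin A w' answer T) (hρ : ρ.Injective) (hρ1 : ρ 1 = 1)
    (hp : Exec p (start w) t s) (hs : ∀ x, s (ρ x) = start w' x) :
    DecidesWithin (.seq p (A.rename ρ)) w answer (t + T) := by
  obtain ⟨u, s', hrun, hu, hans⟩ := hA
  obtain ⟨r, hr, hrs⟩ := hrun.rename hρ s hs
  refine ⟨t + u, r, .seq hp hr, ?_, ?_⟩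
  · push_cast
    gcongr
  · rw [← hans, ← hrs 1, hρ1]

theorem DecidesWithin.mono {A : Prog} {w : List ℤ} {answer : Prop} {T U : ℝ}
    (hA : DecidesWithin A w answer T) (hTU : T ≤ U) : DecidesWithin A w answer U := by
  obtain ⟨t, s, hrun, ht, hans⟩ := hA
  exact ⟨t, s, hrun, ht.trans hTU, hans⟩

end Renaming

section Costs

variable {b : ℕ} {s : Store}

/-- All numbers in the memory are at most `2 ^ b` in absolute value. -/
def Bounded (b : ℕ) (s : Store) : Prop := ∀ x i, |s x i| ≤ 2 ^ b

/-- A bound on the growth of an expression: on a memory bounded by `2 ^ b` its value is at most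
`2 ^ (b * deg)`. -/
def Expr.deg : Expr → ℕ
  | .const c => c.natAbs + 1
  | .get _ _ => 1
  | .add a b => a.deg + b.deg
  | .sub a b => a.deg + b.deg
  | .mul a b => a.deg + b.deg
  | .div a b => a.deg + b.deg

/-- A bound on the cost of an expression: on a memory bounded by `2 ^ b` its evaluation costs at
most `b * weight`. -/
def Expr.weight : Expr → ℕ
  | .const c => (Expr.const c).deg + 2
  | .get _ i => i.weight + 3
  | .add a b => a.weight + b.weight + (a.deg + b.deg + 2)
  | .sub a b => a.weight + b.weight + (a.deg + b.deg + 2)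
  | .mul a b => a.weight + b.weight + (a.deg + b.deg + 2)
  | .div a b => a.weight + b.weight + (a.deg + b.deg + 2)

theorem Expr.one_le_deg (e : Expr) : 1 ≤ e.deg := by
  induction e <;> simp only [Expr.deg] <;> omega

theorem intCost_le {z : ℤ} {d : ℕ} (hb : 1 ≤ b) (hz : |z| ≤ 2 ^ (b * d)) :
    intCost z ≤ b * (d + 2) := by
  have hlt : z.natAbs < 2 ^ (b * d + 1) := by
    have hle : z.natAbs ≤ 2 ^ (b * d) := by
      rw [← Int.natCast_natAbs] at hz
      exact_mod_cast hz
    exact hle.trans_lt (Nat.pow_lt_pow_right one_lt_two (Nat.lt_succ_self _))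
  calc intCost z ≤ b * d + 1 + 1 := Nat.add_le_add_right (Nat.size_le.2 hlt) 1
    _ ≤ b * (d + 2) := by linarith

theorem two_pow_add_two_pow_le {c d : ℕ} (hb : 1 ≤ b) (hc : 1 ≤ c) (hd : 1 ≤ d) :
    (2 : ℤ) ^ (b * c) + 2 ^ (b * d) ≤ 2 ^ (b * (c + d)) := by
  have two_le : ∀ c, 1 ≤ c → (2 : ℤ) ≤ 2 ^ (b * c) := fun c hc =>
    le_self_pow₀ one_le_two (Nat.mul_pos hb hc).ne'
  rw [mul_add, pow_add]
  nlinarith [two_le c hc, two_le d hd]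

theorem Expr.abs_eval_le (hb : 1 ≤ b) (hs : Bounded b s) (e : Expr) :
    |e.eval s| ≤ 2 ^ (b * e.deg) := by
  induction e with
  | const c =>
    have hle : c.natAbs ≤ 2 ^ (b * (c.natAbs + 1)) :=
      Nat.lt_two_pow_self.le.trans (Nat.pow_le_pow_right two_pos ((Nat.le_succ _).trans
        (Nat.le_mul_of_pos_left _ hb)))
    rw [Expr.eval, Expr.deg, ← Int.natCast_natAbs]
    exact_mod_cast hle
  | get x i _ => simpa [Expr.eval, Expr.deg] using hs x (i.eval s)
  | add a c iha ihc =>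
    exact (abs_add_le _ _).trans <| (add_le_add iha ihc).trans <|
      two_pow_add_two_pow_le hb a.one_le_deg c.one_le_deg
  | sub a c iha ihc =>
    exact (abs_sub _ _).trans <| (add_le_add iha ihc).trans <|
      two_pow_add_two_pow_le hb a.one_le_deg c.one_le_deg
  | mul a c iha ihc =>
    rw [Expr.eval, Expr.deg, abs_mul, mul_add, pow_add]
    exact mul_le_mul iha ihc (abs_nonneg _) (by positivity)
  | div a c iha _ =>
    have hdiv : |a.eval s / c.eval s| ≤ |a.eval s| := by
      rw [← Int.natCast_natAbs, ← Int.natCast_natAbs (a.eval s)]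
      exact_mod_cast Int.natAbs_ediv_le_natAbs _ _
    refine (hdiv.trans iha).trans (pow_le_pow_right₀ one_le_two (Nat.mul_le_mul_left _ ?_))
    exact Nat.le_add_right _ _

theorem Expr.cost_le (hb : 1 ≤ b) (hs : Bounded b s) (e : Expr) : e.cost s ≤ b * e.weight := by
  have value_le (e : Expr) : intCost (e.eval s) ≤ b * (e.deg + 2) :=
    intCost_le hb (e.abs_eval_le hb hs)
  induction e with
  | const c => exact value_le (.const c)
  | get x i ih =>
    exact (add_le_add ih (value_le (.get x i))).trans_eq (mul_add b _ _).symm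
  | add a c iha ihc =>
    exact (add_le_add (add_le_add iha ihc) (value_le (.add a c))).trans_eq (by
      simp only [Expr.weight, Expr.deg, mul_add])
  | sub a c iha ihc =>
    exact (add_le_add (add_le_add iha ihc) (value_le (.sub a c))).trans_eq (by
      simp only [Expr.weight, Expr.deg, mul_add])
  | mul a c iha ihc =>
    exact (add_le_add (add_le_add iha ihc) (value_le (.mul a c))).trans_eq (by
      simp only [Expr.weight, Expr.deg, mul_add])
  | div a c iha ihc =>
    exact (add_le_add (add_le_add iha ihc) (value_le (.div a c))).trans_eq (by
      simp only [Expr.weight, Expr.deg, mul_add])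

theorem Expr.cost_add_one_le {R : ℕ} (hb : 1 ≤ b) (hR : 1 ≤ R) (hs : Bounded b s) (e : Expr) :
    e.cost s + 1 ≤ b * R * (e.weight + 1) := by
  have hcost := e.cost_le hb hs
  calc e.cost s + 1 ≤ b * 1 * (e.weight + 1) := by nlinarith
    _ ≤ b * R * (e.weight + 1) := by gcongr

end Costs

section TotalCorrectness

/-- The memory obtained from `s` by writing `v` to cell `i` of array `x`. -/
def Store.put (s : Store) (x : ℕ) (i v : ℤ) : Store :=
  Function.update s x (Function.update (s x) i v)

theorem Store.put_array (s : Store) (x : ℕ) (i v : ℤ) :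
    s.put x i v x = Function.update (s x) i v := by
  simp [Store.put]

@[simp] theorem Store.put_self (s : Store) (x : ℕ) (i v : ℤ) : s.put x i v x i = v := by
  simp [Store.put]

@[simp] theorem Store.put_of_ne (s : Store) {x y : ℕ} (h : y ≠ x) (i v : ℤ) :
    s.put x i v y = s y := by
  simp [Store.put, h]

/-- The cost of executing every instruction of a program once, in multiples of `b`, on a memory
bounded by `2 ^ b`. -/
def Prog.weight : Prog → ℕ
  | .skip => 1
  | .assign _ i e => i.weight + e.weight + 1
  | .seq p q => p.weight + q.weight
  | .ite e p q => e.weight + 1 + (p.weight + q.weight)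
  | .loop e p => e.weight + 1 + p.weight

/-- Total correctness with costs: started on `s`, if that is bounded by `2 ^ b`, the program `p`
executes each of its instructions at most `R` times and halts with a memory that is bounded by
`2 ^ b` again and satisfies `Q`. -/
def Runs (b R : ℕ) (p : Prog) (s : Store) (Q : Store → Prop) : Prop :=
  1 ≤ b → 1 ≤ R → Bounded b s →
    ∃ t s', Exec p s t s' ∧ t ≤ b * R * p.weight ∧ Bounded b s' ∧ Q s'

variable {b R : ℕ} {s : Store} {Q : Store → Prop}

theorem Runs.mono {p : Prog} {Q' : Store → Prop} (h : Runs b R p s Q) (hQ : ∀ s', Q s' → Q' s') :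
    Runs b R p s Q' := fun hb hR hs => by
  obtain ⟨t, s', hrun, ht, hs', hQs'⟩ := h hb hR hs
  exact ⟨t, s', hrun, ht, hs', hQ s' hQs'⟩

theorem Runs.skip (hQ : Q s) : Runs b R .skip s Q := fun hb hR hs =>
  ⟨1, s, .skip s, Nat.mul_pos (Nat.mul_pos hb hR) one_pos, hs, hQ⟩

theorem Runs.assign {x : ℕ} {i e : Expr} (he : |e.eval s| ≤ 2 ^ b)
    (hQ : Q (s.put x (i.eval s) (e.eval s))) : Runs b R (.assign x i e) s Q := fun hb hR hs => by
  refine ⟨_, _, .assign x i e s, ?_, fun y l => ?_, hQ⟩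
  · calc i.cost s + e.cost s + 1 ≤ b * R * i.weight + b * R * (e.weight + 1) := by
          rw [add_assoc]
          refine add_le_add ((i.cost_le hb hs).trans ?_) (e.cost_add_one_le hb hR hs)
          gcongr
          exact Nat.le_mul_of_pos_right b hR
      _ = b * R * (Prog.assign x i e).weight := by rw [Prog.weight]; ring
  · obtain rfl | hy := eq_or_ne y x
    · obtain rfl | hl := eq_or_ne l (i.eval s)
      · simpa using he
      · simpa [hl] using hs y l
    · simpa [hy] using hs y l

theorem Runs.seq {p q : Prog} (h : Runs b R p s fun s' => Runs b R q s' Q) :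
    Runs b R (.seq p q) s Q := fun hb hR hs => by
  obtain ⟨t, s', hp, ht, hs', hq⟩ := h hb hR hs
  obtain ⟨u, s'', hq, hu, hs'', hQ⟩ := hq hb hR hs'
  exact ⟨_, _, .seq hp hq, by rw [Prog.weight, mul_add]; exact add_le_add ht hu, hs'', hQ⟩

theorem Runs.ite {e : Expr} {p q : Prog} (hp : 0 < e.eval s → Runs b R p s Q)
    (hq : ¬ 0 < e.eval s → Runs b R q s Q) :
    Runs b R (.ite e p q) s Q := fun hb hR hs => by
  have hc := e.cost_add_one_le hb hR hs
  by_cases h : 0 < e.eval s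
  · obtain ⟨t, s', hrun, ht, hs', hQ⟩ := hp h hb hR hs
    exact ⟨_, _, .iteTrue h hrun, by rw [Prog.weight, mul_add, mul_add _ p.weight]; omega, hs', hQ⟩
  · obtain ⟨t, s', hrun, ht, hs', hQ⟩ := hq h hb hR hs
    exact ⟨_, _, .iteFalse h hrun, by rw [Prog.weight, mul_add, mul_add _ p.weight]; omega, hs', hQ⟩

theorem Runs.loop {e : Expr} {p : Prog} {m n : ℕ} (I : ℕ → Store → Prop) (hm : n < m) (h0 : I 0 s)
    (hstep : ∀ i < n, ∀ s, I i s → 0 < e.eval s ∧ Runs b R p s (I (i + 1)))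
    (hend : ∀ s, I n s → ¬ 0 < e.eval s ∧ Q s) :
    Runs b (m * R) (.loop e p) s Q := by
  intro hb hmR hs₀
  have hR : 1 ≤ R := Nat.pos_of_mul_pos_left hmR
  suffices H : ∀ d i, i + d = n → ∀ s, I i s → Bounded b s → ∃ t s', Exec (.loop e p) s t s' ∧
      t ≤ (d + 1) * (b * R * (e.weight + 1 + p.weight)) ∧ Bounded b s' ∧ Q s' by
    obtain ⟨t, s', hrun, ht, hs', hQ⟩ := H n 0 (zero_add n) s h0 hs₀
    refine ⟨t, s', hrun, ht.trans ?_, hs', hQ⟩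
    calc (n + 1) * (b * R * (e.weight + 1 + p.weight))
        ≤ m * (b * R * (e.weight + 1 + p.weight)) := by gcongr; omega
      _ = b * (m * R) * (Prog.loop e p).weight := by rw [Prog.weight]; ring
  intro d
  induction d with
  | zero =>
    rintro i rfl s hI hs
    obtain ⟨hneg, hQ⟩ := hend s hI
    refine ⟨_, _, .loopDone hneg, (e.cost_add_one_le hb hR hs).trans ?_, hs, hQ⟩
    rw [zero_add, one_mul]
    exact Nat.mul_le_mul_left _ (Nat.le_add_right _ _)
  | succ d ih =>
    rintro i hi s hI hs
    obtain ⟨hpos, hbody⟩ := hstep i (by omega) s hI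
    obtain ⟨t, s', hrun, ht, hs', hI'⟩ := hbody hb hR hs
    obtain ⟨u, s'', hrest, hu, hs'', hQ⟩ := ih (i + 1) (by omega) s' hI' hs'
    refine ⟨_, _, .loopStep hpos hrun hrest, ?_, hs'', hQ⟩
    have hround : e.cost s + 1 + t ≤ b * R * (e.weight + 1 + p.weight) := by
      rw [mul_add (b * R)]
      exact add_le_add (e.cost_add_one_le hb hR hs) ht
    linarith

end TotalCorrectness

section Programming

instance : Add Expr := ⟨.add⟩
instance : Sub Expr := ⟨.sub⟩
instance : Mul Expr := ⟨.mul⟩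
instance : Div Expr := ⟨.div⟩
instance : NatCast Expr := ⟨fun n => .const n⟩
instance (n : ℕ) : OfNat Expr n := ⟨.const n⟩

/-- Sequential composition. -/
notation:60 p:61 ";;" q:60 => Prog.seq p q

/-- The content of cell `0` of array `x`, used as a register. -/
def reg (x : ℕ) : Expr := .get x 0

/-- The assignment to cell `0` of array `x`. -/
def set (x : ℕ) (e : Expr) : Prog := .assign x 0 e

/-- `forRange c e p` executes `p` for the values `0, 1, …, e - 1` of the register `c`. -/
def forRange (c : ℕ) (e : Expr) (p : Prog) : Prog :=
  set c 0 ;; .loop (e - reg c) (p ;; set c (reg c + 1))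

variable {b R : ℕ} {s : Store} {Q : Store → Prop}

@[simp] theorem Expr.eval_add (s : Store) (a c : Expr) : (a + c).eval s = a.eval s + c.eval s := rfl

@[simp] theorem Expr.eval_sub (s : Store) (a c : Expr) : (a - c).eval s = a.eval s - c.eval s := rfl

@[simp] theorem Expr.eval_mul (s : Store) (a c : Expr) : (a * c).eval s = a.eval s * c.eval s := rfl

@[simp] theorem Expr.eval_div (s : Store) (a c : Expr) : (a / c).eval s = a.eval s / c.eval s := rfl

@[simp] theorem Expr.eval_natCast (s : Store) (n : ℕ) : (n : Expr).eval s = n := rfl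

@[simp] theorem Expr.eval_ofNat (s : Store) (n : ℕ) : Expr.eval s ofNat(n) = OfNat.ofNat n := rfl

@[simp] theorem Expr.eval_get (s : Store) (x : ℕ) (i : Expr) :
    (Expr.get x i).eval s = s x (i.eval s) := rfl

@[simp] theorem eval_reg (s : Store) (x : ℕ) : (reg x).eval s = s x 0 := rfl

theorem Runs.set {x : ℕ} {e : Expr} (he : |e.eval s| ≤ 2 ^ b) (hQ : Q (s.put x 0 (e.eval s))) :
    Runs b R (RAM.set x e) s Q :=
  Runs.assign he hQ

theorem Runs.forRange {c : ℕ} {e : Expr} {p : Prog} {m n : ℕ} (I : ℕ → Store → Prop) (hm : n < m)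
    (hn : (n : ℤ) ≤ 2 ^ b) (hput : ∀ i s v, I i s → I i (s.put c 0 v))
    (he : ∀ i s, I i s → e.eval s = n) (h0 : I 0 s)
    (hstep : ∀ i < n, ∀ s, I i s → s c 0 = i → Runs b R p s fun s' => I (i + 1) s' ∧ s' c 0 = i)
    (hQ : ∀ s', I n s' → Q s') : Runs b (m * R) (RAM.forRange c e p) s Q := by
  refine .seq (.set (by simp) (.loop (n := n) (fun i s => I i s ∧ s c 0 = i) hm
    ⟨hput _ _ _ h0, by simp⟩ ?_ ?_))
  · rintro i hi s ⟨hI, hc⟩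
    refine ⟨by simpa [he i s hI, hc] using hi, .seq ((hstep i hi s hI hc).mono ?_)⟩
    rintro s' ⟨hI', hc'⟩
    refine .set ?_ ⟨hput _ _ _ hI', by simp [hc']⟩
    have : ((i : ℤ) + 1) ≤ n := by exact_mod_cast hi
    simpa [hc', abs_of_nonneg (by positivity : (0 : ℤ) ≤ i + 1)] using this.trans hn
  · rintro s ⟨hI, hc⟩
    exact ⟨by simp [he n s hI, hc], hQ s hI⟩

end Programming

section ListsInArrays

/-- The content of an array that holds the list `l` from cell `0` on, and `0` elsewhere. -/
def ofList (l : List ℤ) : ℤ → ℤ := fun i => if 0 ≤ i then l.getD i.toNat 0 else 0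

/-- All entries and indices of `l` are at most `2 ^ b` in absolute value. -/
def Fits (b : ℕ) (l : List ℤ) : Prop := l.length ≤ 2 ^ b ∧ ∀ z ∈ l, |z| ≤ 2 ^ b

theorem start_zero (l : List ℤ) : start l 0 = ofList l := by
  funext i
  simp [start, ofList]

theorem start_of_ne_zero (l : List ℤ) {x : ℕ} (hx : x ≠ 0) : start l x = 0 := by
  funext i
  simp [start, hx]

theorem ofList_natCast (l : List ℤ) (i : ℕ) : ofList l i = l.getD i 0 := by
  simp [ofList]

theorem ofList_nil : ofList [] = 0 := by
  funext i
  simp [ofList]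

theorem update_ofList (l : List ℤ) (v : ℤ) :
    Function.update (ofList l) (l.length : ℤ) v = ofList (l ++ [v]) := by
  funext i
  obtain rfl | hi := eq_or_ne i l.length
  · simp [ofList]
  · rw [Function.update_of_ne hi]
    unfold ofList
    split_ifs with h
    · obtain ⟨m, rfl⟩ := Int.eq_ofNat_of_zero_le h
      have hm : m ≠ l.length := by exact_mod_cast hi
      simp only [Int.toNat_natCast, List.getD_eq_getElem?_getD]
      rcases lt_or_gt_of_ne hm with h' | h'
      · rw [List.getElem?_append_left h']
      · rw [List.getElem?_eq_none h'.le, List.getElem?_eq_none (by simpa using h')]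
    · rfl

theorem Fits.abs_getD_le {b : ℕ} {l : List ℤ} (h : Fits b l) (i : ℕ) : |l.getD i 0| ≤ 2 ^ b := by
  rcases lt_or_ge i l.length with hi | hi
  · rw [List.getD_eq_getElem _ _ hi]
    exact h.2 _ (List.getElem_mem hi)
  · rw [List.getD_eq_default _ _ hi]
    simp

theorem bounded_start {b : ℕ} {l : List ℤ} (h : Fits b l) : Bounded b (start l) := by
  intro x i
  unfold start
  split_ifs
  · exact h.abs_getD_le _
  · simp

end ListsInArrays

end RAM

/-- The point with abscissa `x` on the parabola `y = x ^ 2`. -/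
def onParabola (x : ℤ) : ℤ × ℤ := (x, x * x)

section Parabola

theorem onParabola_injective : Function.Injective onParabola := fun _ _ h => congrArg Prod.fst h

theorem abs_onParabola_le {x : ℤ} {n : ℕ} (hx : |x| ≤ n) :
    |(onParabola x).1| ≤ (n : ℤ) ^ 2 ∧ |(onParabola x).2| ≤ (n : ℤ) ^ 2 := by
  have hn : (n : ℤ) ≤ n ^ 2 := by exact_mod_cast Nat.le_self_pow two_ne_zero n
  refine ⟨hx.trans hn, ?_⟩
  rw [onParabola, abs_mul, sq]
  exact mul_self_le_mul_self (abs_nonneg x) hx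

theorem orient_onParabola (a b c : ℤ) :
    orient (onParabola a) (onParabola b) (onParabola c) = (b - a) * (c - a) * (c - b) := by
  simp only [orient, onParabola]
  ring

theorem isConvexPolygon_map_onParabola {l : List ℤ} (hl : l.Pairwise (· < ·)) (h3 : 3 ≤ l.length) :
    IsConvexPolygon (l.map onParabola) := by
  refine ⟨by simpa using h3, fun i j m hij hjm => ?_⟩
  have getElem_lt : ∀ (i j : ℕ) (hi : i < l.length) (hj : j < l.length), i < j → l[i] < l[j] :=
    List.pairwise_iff_getElem.1 hl
  simp only [List.get_eq_getElem, List.getElem_map, orient_onParabola]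
  exact mul_pos (mul_pos (sub_pos.2 (getElem_lt _ _ _ _ hij))
    (sub_pos.2 (getElem_lt _ _ _ _ (hij.trans hjm)))) (sub_pos.2 (getElem_lt _ _ _ _ hjm))

theorem toPlane_onParabola_mem_region {l : List ℤ} {x : ℤ} :
    toPlane (onParabola x) ∈ region (l.map onParabola) ↔ x ∈ l := by
  refine ⟨fun h => ?_, fun h => subset_convexHull ℝ _ ⟨_, List.mem_map_of_mem h, rfl⟩⟩
  by_contra hx
  -- The tangent at `x` separates the point at `x` from the rest of the parabola.
  have tangent : IsLinearMap ℝ fun p : ℝ × ℝ => p.2 - 2 * x * p.1 :=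
    ⟨fun p q => by simp only [Prod.snd_add, Prod.fst_add]; ring,
      fun c p => by simp only [Prod.smul_snd, Prod.smul_fst, smul_eq_mul]; ring⟩
  have region_subset : region (l.map onParabola) ⊆ {p | -(x : ℝ) ^ 2 < p.2 - 2 * x * p.1} := by
    refine convexHull_min ?_ (convex_halfSpace_gt tangent _)
    rintro p ⟨q, hq, rfl⟩
    obtain ⟨y, hy, rfl⟩ := List.mem_map.1 hq
    have hne : (y : ℝ) - x ≠ 0 := by
      rw [sub_ne_zero]
      exact_mod_cast fun h : y = x => hx (h ▸ hy)
    have hpos : 0 < ((y : ℝ) - x) ^ 2 := by positivity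
    simp only [toPlane, onParabola, Set.mem_ofPred_eq, Int.cast_mul]
    linarith
  have hlt := region_subset h
  simp only [toPlane, onParabola, Set.mem_ofPred_eq, Int.cast_mul] at hlt
  linarith

end Parabola

namespace CoverInstance

variable {I : CoverInstance}

theorem length_encodePoints (v : List (ℤ × ℤ)) : (encodePoints v).length = 2 * v.length + 1 := by
  simp [encodePoints, mul_comm]

theorem Compact.length_encode_le (hI : I.Compact) (k : ℕ) :
    (I.encode k).length ≤ (2 * I.card + 3) ^ 2 := by
  have hpoly : (I.polygons.flatMap encodePoints).length ≤ I.polygons.length * (2 * I.card + 1) := by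
    rw [List.length_flatMap, ← smul_eq_mul, ← List.length_map]
    refine List.sum_le_card_nsmul _ _ fun n hn => ?_
    obtain ⟨v, hv, rfl⟩ := List.mem_map.1 hn
    rw [length_encodePoints]
    linarith [(hI.1 v hv).1]
  have hle : I.polygons.length * (2 * I.card + 1) ≤ I.card * (2 * I.card + 1) :=
    Nat.mul_le_mul_right _ (Nat.le_add_right _ _)
  have hpoints : I.points.length ≤ I.card := Nat.le_add_left _ _
  simp only [encode, List.cons_append, List.length_cons, List.length_append, length_encodePoints]
  nlinarith

theorem abs_le_of_mem_encodePoints {v : List (ℤ × ℤ)} {B z : ℤ} (hlen : (v.length : ℤ) ≤ B)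
    (hB : ∀ q ∈ v, |q.1| ≤ B ∧ |q.2| ≤ B) (hz : z ∈ encodePoints v) : |z| ≤ B := by
  simp only [encodePoints, List.mem_cons, List.mem_flatMap, List.not_mem_nil, or_false] at hz
  obtain rfl | ⟨q, hq, rfl | rfl⟩ := hz
  · simpa using hlen
  · exact (hB q hq).1
  · exact (hB q hq).2

theorem Compact.abs_le_of_mem_encode (hI : I.Compact) {k : ℕ} {z : ℤ} (hz : z ∈ I.encode k) :
    |z| ≤ max (k : ℤ) (I.card ^ 2) := by
  have hcard : (I.card : ℤ) ≤ I.card ^ 2 := by exact_mod_cast Nat.le_self_pow two_ne_zero _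
  have hpoly : (I.polygons.length : ℤ) ≤ I.card := by exact_mod_cast Nat.le_add_right _ _
  have hpoints : (I.points.length : ℤ) ≤ I.card := by exact_mod_cast Nat.le_add_left _ _
  simp only [encode, List.cons_append, List.mem_cons, List.mem_append, List.mem_flatMap] at hz
  obtain rfl | rfl | ⟨v, hv, hz⟩ | hz := hz
  · simp
  · exact le_max_of_le_right (by simpa using hpoly.trans hcard)
  · obtain ⟨hlen, hv⟩ := hI.1 v hv
    have hlen : (v.length : ℤ) ≤ I.card := by exact_mod_cast hlen
    exact le_max_of_le_right (abs_le_of_mem_encodePoints (hlen.trans hcard) hv hz)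
  · exact le_max_of_le_right (abs_le_of_mem_encodePoints (hpoints.trans hcard) hI.2 hz)

end CoverInstance

namespace CNF

variable (φ : CNF) (k : ℕ)

/-- The variables are divided into `k` groups of this many variables each; the last groups may be
incomplete. -/
def groupSize : ℕ := φ.numVars / k + 1

/-- The number of pairs of a group and an assignment to its variables. Such a pair is coded by a
number: the quotient by `2 ^ groupSize` is the group, the low bits are the assignment. -/
def numCodes : ℕ := k * 2 ^ φ.groupSize k

/-- The group of the pair with code `j`. -/
def group (j : ℕ) : ℕ := j / 2 ^ φ.groupSize k

/-- The partial assignment with code `j` makes the literal `l` true. -/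
def LiteralTrue (j : ℕ) (l : Fin φ.numVars × Bool) : Prop :=
  l.1.val / φ.groupSize k = φ.group k j ∧ j.testBit (l.1.val % φ.groupSize k) = l.2

/-- The partial assignment with code `j` makes the clause `c` true. -/
def ClauseTrue (j : ℕ) (c : List (Fin φ.numVars × Bool)) : Prop := ∃ l ∈ c, φ.LiteralTrue k j l

instance (j : ℕ) (l : Fin φ.numVars × Bool) : Decidable (φ.LiteralTrue k j l) :=
  inferInstanceAs (Decidable (_ ∧ _))

instance (j : ℕ) (c : List (Fin φ.numVars × Bool)) : Decidable (φ.ClauseTrue k j c) :=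
  inferInstanceAs (Decidable (∃ l ∈ c, φ.LiteralTrue k j l))

/-- The number of points of the instance: one for each clause and one for each group. -/
def numPoints : ℕ := φ.clauses.length + k

/-- The abscissa of the point number `i`: the points of the clauses come first, followed by those of
the groups. They are two apart, which leaves an unused abscissa next to each. -/
def pointAbscissa (i : ℕ) : ℤ := 2 * i - φ.numPoints k

/-- The abscissa that represents the clause number `m` in the polygon with code `j`: the one of the
clause's point if the clause is satisfied, and an unused one otherwise. -/
def clauseAbscissa (j m : ℕ) : ℤ :=
  φ.pointAbscissa k m + if φ.ClauseTrue k j (φ.clauses.getD m []) then 0 else 1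

/-- The abscissae of the vertices of the polygon with code `j`. The first one is common to all
polygons and the last one is different for all of them. -/
def abscissae (j : ℕ) : List ℤ :=
  [-(φ.numPoints k : ℤ) - 1] ++ (List.range φ.clauses.length).map (φ.clauseAbscissa k j) ++
    [φ.pointAbscissa k (φ.clauses.length + φ.group k j)] ++ [(φ.numPoints k : ℤ) + j]

section Abscissae

variable {φ k}

theorem two_mul_le_numCodes : 2 * k ≤ φ.numCodes k := by
  rw [mul_comm]
  exact Nat.mul_le_mul_left k (Nat.le_self_pow (Nat.succ_ne_zero _) 2)

theorem group_lt {j : ℕ} (hj : j < φ.numCodes k) : φ.group k j < k :=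
  Nat.div_lt_of_lt_mul (by rwa [mul_comm])

theorem length_abscissae (j : ℕ) : (φ.abscissae k j).length = φ.clauses.length + 3 := by
  simp [abscissae]

theorem mem_abscissae {j : ℕ} {x : ℤ} : x ∈ φ.abscissae k j ↔ x = -(φ.numPoints k : ℤ) - 1 ∨
    (∃ m < φ.clauses.length, φ.clauseAbscissa k j m = x) ∨
    x = φ.pointAbscissa k (φ.clauses.length + φ.group k j) ∨ x = φ.numPoints k + j := by
  simp [abscissae]

theorem clauseAbscissa_mem_Icc (j m : ℕ) :
    φ.clauseAbscissa k j m ∈ Set.Icc (φ.pointAbscissa k m) (φ.pointAbscissa k m + 1) := by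
  unfold clauseAbscissa
  split_ifs <;> simp

theorem pairwise_abscissae {j : ℕ} (hj : j < φ.numCodes k) :
    (φ.abscissae k j).Pairwise (· < ·) := by
  have hg := group_lt hj
  have hclause (m : ℕ) := clauseAbscissa_mem_Icc (φ := φ) (k := k) j m
  simp only [Set.mem_Icc, pointAbscissa, numPoints] at hclause
  have hclauses : ((List.range φ.clauses.length).map (φ.clauseAbscissa k j)).Pairwise (· < ·) := by
    rw [List.pairwise_map]
    refine List.pairwise_lt_range.imp fun {a b} hab => ?_
    have := hclause a
    have := hclause b
    omega
  simp only [abscissae, pointAbscissa, numPoints, List.pairwise_append, List.pairwise_singleton,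
    hclauses, List.mem_append, List.mem_singleton, List.mem_map, List.mem_range, true_and]
  refine ⟨⟨?_, ?_⟩, ?_⟩
  · rintro _ rfl _ ⟨m, -, rfl⟩
    have := hclause m
    omega
  · rintro _ (rfl | ⟨m, hm, rfl⟩) _ rfl
    · omega
    · have := hclause m
      omega
  · rintro _ ((rfl | ⟨m, hm, rfl⟩) | rfl) _ rfl
    · omega
    · have := hclause m
      omega
    · omega

theorem numPoints_add_mem_abscissae {i j : ℕ} (hi : i < φ.numCodes k) :
    (φ.numPoints k + (j : ℤ)) ∈ φ.abscissae k i ↔ i = j := by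
  have hg := group_lt hi
  rw [mem_abscissae]
  refine ⟨?_, by rintro rfl; simp⟩
  simp only [pointAbscissa, numPoints]
  rintro (h | ⟨m, hm, h⟩ | h | h)
  · omega
  · have := clauseAbscissa_mem_Icc (φ := φ) (k := k) i m
    simp only [Set.mem_Icc, pointAbscissa, numPoints] at this
    omega
  · omega
  · omega

theorem pointAbscissa_mem_abscissae_of_lt {j m : ℕ} (hm : m < φ.clauses.length) :
    φ.pointAbscissa k m ∈ φ.abscissae k j ↔ φ.ClauseTrue k j φ.clauses[m] := by
  rw [mem_abscissae]
  refine ⟨?_, fun h => .inr (.inl ⟨m, hm, by simp [clauseAbscissa, hm, h]⟩)⟩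
  rintro (h | ⟨m', -, h⟩ | h | h)
  · simp only [pointAbscissa, numPoints] at h
    omega
  · have hm' := clauseAbscissa_mem_Icc (φ := φ) (k := k) j m'
    rw [h, Set.mem_Icc] at hm'
    obtain rfl : m' = m := by simp only [pointAbscissa] at hm'; omega
    simpa [clauseAbscissa, hm] using h
  · simp only [pointAbscissa, numPoints] at h
    omega
  · simp only [pointAbscissa, numPoints] at h
    omega

theorem pointAbscissa_add_mem_abscissae {g j : ℕ} (hg : g < k) :
    φ.pointAbscissa k (φ.clauses.length + g) ∈ φ.abscissae k j ↔ φ.group k j = g := by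
  rw [mem_abscissae]
  refine ⟨?_, by rintro rfl; simp⟩
  simp only [pointAbscissa, numPoints]
  rintro (h | ⟨m, hm, h⟩ | h | h)
  · omega
  · have := clauseAbscissa_mem_Icc (φ := φ) (k := k) j m
    simp only [Set.mem_Icc, pointAbscissa, numPoints] at this
    omega
  · omega
  · omega

theorem abs_le_of_mem_abscissae {j : ℕ} {x : ℤ} (hj : j < φ.numCodes k) (hx : x ∈ φ.abscissae k j) :
    |x| ≤ (φ.numCodes k + φ.numPoints k : ℕ) := by
  have hg := group_lt hj
  rw [abs_le]
  rw [mem_abscissae] at hx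
  obtain rfl | ⟨m, hm, rfl⟩ | rfl | rfl := hx
  · omega
  · have := clauseAbscissa_mem_Icc (φ := φ) (k := k) j m
    simp only [Set.mem_Icc, pointAbscissa, numPoints] at this ⊢
    omega
  · simp only [pointAbscissa, numPoints]
    omega
  · omega

end Abscissae

/-- The covering instance for `φ`: one polygon for each partial assignment, and one point for each
clause and each group. -/
def toCover : CoverInstance where
  polygons := (List.range (φ.numCodes k)).map fun j => (φ.abscissae k j).map onParabola
  points := (List.range (φ.numPoints k)).map fun i => onParabola (φ.pointAbscissa k i)
  convex := by
    simp only [List.mem_map, List.mem_range]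
    rintro _ ⟨j, hj, rfl⟩
    exact isConvexPolygon_map_onParabola (pairwise_abscissae hj) (by simp [length_abscissae])
  polygons_distinct := by
    rw [List.pairwise_map]
    refine List.pairwise_lt_range.imp_of_mem fun {i j} hi hj hij hregion => ?_
    rw [List.mem_range] at hi hj
    have hmem := toPlane_onParabola_mem_region.2 ((numPoints_add_mem_abscissae hj).2 rfl)
    rw [← hregion, toPlane_onParabola_mem_region, numPoints_add_mem_abscissae hi] at hmem
    exact hij.ne hmem
  points_distinct := by
    refine List.nodup_range.map fun i j h => ?_
    have := onParabola_injective h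
    simp only [pointAbscissa] at this
    omega

section Cover

variable {φ k}

theorem card_toCover : (φ.toCover k).card = φ.numCodes k + φ.numPoints k := by
  simp [toCover, CoverInstance.card]

theorem compact_toCover (hk : 1 ≤ k) : (φ.toCover k).Compact := by
  have hN : 2 * k ≤ φ.numCodes k := two_mul_le_numCodes
  rw [CoverInstance.Compact, card_toCover]
  simp only [toCover, List.mem_map, List.mem_range]
  constructor
  · rintro _ ⟨j, hj, rfl⟩
    refine ⟨by rw [List.length_map, length_abscissae, numPoints]; omega, fun q hq => ?_⟩
    obtain ⟨x, hx, rfl⟩ := List.mem_map.1 hq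
    exact abs_onParabola_le (abs_le_of_mem_abscissae hj hx)
  · rintro _ ⟨i, hi, rfl⟩
    refine abs_onParabola_le ?_
    rw [abs_le, pointAbscissa]
    omega

theorem toPlane_mem_region_toCover {i : ℕ} (j : Fin (φ.toCover k).polygons.length) :
    toPlane (onParabola (φ.pointAbscissa k i)) ∈ region ((φ.toCover k).polygons.get j) ↔
      φ.pointAbscissa k i ∈ φ.abscissae k j := by
  rw [← toPlane_onParabola_mem_region, List.get_eq_getElem]
  simp only [toCover, List.getElem_map, List.getElem_range]

theorem hasCover_toCover_iff_exists_abscissae : (φ.toCover k).HasCover k ↔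
    ∃ S ⊆ Finset.range (φ.numCodes k), S.card = k ∧
      ∀ i < φ.numPoints k, ∃ j ∈ S, φ.pointAbscissa k i ∈ φ.abscissae k j := by
  have hlen : (φ.toCover k).polygons.length = φ.numCodes k := by simp [toCover]
  constructor
  · rintro ⟨S, hS, hcov⟩
    refine ⟨S.map Fin.valEmbedding, fun j hj => ?_, by simpa using hS, fun i hi => ?_⟩
    · obtain ⟨j, -, rfl⟩ := Finset.mem_map.1 hj
      exact Finset.mem_range.2 (hlen ▸ j.2)
    · obtain ⟨j, hj, hmem⟩ := hcov _ (List.mem_map.2 ⟨i, List.mem_range.2 hi, rfl⟩)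
      exact ⟨j, Finset.mem_map_of_mem _ hj, (toPlane_mem_region_toCover j).1 hmem⟩
  · rintro ⟨S, hSN, hS, hcov⟩
    have hlt : ∀ j ∈ S, j < (φ.toCover k).polygons.length := fun j hj =>
      hlen ▸ Finset.mem_range.1 (hSN hj)
    refine ⟨S.attachFin hlt, by rwa [Finset.card_attachFin], fun p hp => ?_⟩
    obtain ⟨i, hi, rfl⟩ := List.mem_map.1 hp
    obtain ⟨j, hj, hmem⟩ := hcov i (List.mem_range.1 hi)
    exact ⟨⟨j, hlt j hj⟩, (Finset.mem_attachFin hlt).2 hj, (toPlane_mem_region_toCover _).2 hmem⟩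

theorem forall_pointAbscissa_iff {S : Finset ℕ} :
    (∀ i < φ.numPoints k, ∃ j ∈ S, φ.pointAbscissa k i ∈ φ.abscissae k j) ↔
      (∀ c ∈ φ.clauses, ∃ j ∈ S, φ.ClauseTrue k j c) ∧ ∀ g < k, ∃ j ∈ S, φ.group k j = g := by
  constructor
  · refine fun h => ⟨fun c hc => ?_, fun g hg => ?_⟩
    · obtain ⟨m, hm, rfl⟩ := List.getElem_of_mem hc
      obtain ⟨j, hj, hmem⟩ := h m (Nat.lt_add_right k hm)
      exact ⟨j, hj, (pointAbscissa_mem_abscissae_of_lt hm).1 hmem⟩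
    · obtain ⟨j, hj, hmem⟩ := h (φ.clauses.length + g) (Nat.add_lt_add_left hg _)
      exact ⟨j, hj, (pointAbscissa_add_mem_abscissae hg).1 hmem⟩
  · rintro ⟨hclauses, hgroups⟩ i hi
    rcases lt_or_ge i φ.clauses.length with hm | hm
    · obtain ⟨j, hj, htrue⟩ := hclauses _ (List.getElem_mem hm)
      exact ⟨j, hj, (pointAbscissa_mem_abscissae_of_lt hm).2 htrue⟩
    · obtain ⟨g, rfl⟩ := Nat.exists_eq_add_of_le hm
      have hg : g < k := Nat.lt_of_add_lt_add_left hi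
      obtain ⟨j, hj, hgroup⟩ := hgroups g hg
      exact ⟨j, hj, (pointAbscissa_add_mem_abscissae hg).2 hgroup⟩

theorem div_groupSize_lt (hk : 0 < k) (v : Fin φ.numVars) : v.val / φ.groupSize k < k := by
  refine Nat.div_lt_of_lt_mul (v.2.trans ?_)
  rw [groupSize, mul_comm]
  exact Nat.lt_mul_div_succ _ hk

theorem satisfiable_of_codes (hk : 0 < k) {S : Finset ℕ} (hSN : S ⊆ Finset.range (φ.numCodes k))
    (hS : S.card = k) (hclauses : ∀ c ∈ φ.clauses, ∃ j ∈ S, φ.ClauseTrue k j c)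
    (hgroups : ∀ g < k, ∃ j ∈ S, φ.group k j = g) : φ.Satisfiable := by
  have group_injOn : Set.InjOn (φ.group k) S :=
    Finset.injOn_of_surjOn_of_card_le (t := Finset.range k) (φ.group k)
      (fun j hj => by simpa using group_lt (Finset.mem_range.1 (hSN hj)))
      (fun g hg => hgroups g (by simpa using hg)) (by simp [hS])
  choose code code_mem group_code using hgroups
  refine ⟨fun v => (code _ (div_groupSize_lt hk v)).testBit (v.val % φ.groupSize k),
    fun c hc => ?_⟩
  obtain ⟨j, hj, l, hl, hgroup, hbit⟩ := hclauses c hc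
  have hcode : code _ (div_groupSize_lt hk l.1) = j :=
    group_injOn (code_mem _ _) hj ((group_code _ _).trans hgroup)
  exact ⟨l, hl, by simpa only [hcode] using hbit⟩

/-- The code of the restriction of the assignment `a` to the group `g`; variables that do not exist
are set to `false`. -/
def assignmentCode (k : ℕ) (a : Fin φ.numVars → Bool) (g : ℕ) : ℕ :=
  2 ^ φ.groupSize k * g + Nat.ofBits fun i : Fin (φ.groupSize k) =>
    if h : g * φ.groupSize k + i < φ.numVars then a ⟨_, h⟩ else false

theorem group_assignmentCode (a : Fin φ.numVars → Bool) (g : ℕ) :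
    φ.group k (assignmentCode k a g) = g := by
  rw [group, assignmentCode, Nat.mul_add_div (by positivity),
    Nat.div_eq_of_lt (Nat.ofBits_lt_two_pow _), add_zero]

theorem assignmentCode_lt (a : Fin φ.numVars → Bool) {g : ℕ} (hg : g < k) :
    assignmentCode k a g < φ.numCodes k := by
  have : assignmentCode k a g / 2 ^ φ.groupSize k < k := (group_assignmentCode a g).trans_lt hg
  rwa [Nat.div_lt_iff_lt_mul (by positivity)] at this

theorem testBit_assignmentCode (a : Fin φ.numVars → Bool) (v : Fin φ.numVars) :
    (assignmentCode k a (v.val / φ.groupSize k)).testBit (v.val % φ.groupSize k) = a v := by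
  have hmod : v.val % φ.groupSize k < φ.groupSize k := Nat.mod_lt _ (Nat.succ_pos _)
  have hv : v.val / φ.groupSize k * φ.groupSize k + v.val % φ.groupSize k = v.val :=
    Nat.div_add_mod' _ _
  rw [assignmentCode, Nat.testBit_two_pow_mul_add _ (Nat.ofBits_lt_two_pow _), if_pos hmod,
    Nat.testBit_ofBits_lt _ _ hmod]
  simp [hv]

theorem exists_codes_of_satisfiable (hk : 0 < k) (hφ : φ.Satisfiable) :
    ∃ S ⊆ Finset.range (φ.numCodes k), S.card = k ∧
      (∀ c ∈ φ.clauses, ∃ j ∈ S, φ.ClauseTrue k j c) ∧ ∀ g < k, ∃ j ∈ S, φ.group k j = g := by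
  obtain ⟨a, ha⟩ := hφ
  have mem_image (g : ℕ) (hg : g < k) :
      assignmentCode k a g ∈ (Finset.range k).image (assignmentCode k a) :=
    Finset.mem_image_of_mem _ (Finset.mem_range.2 hg)
  refine ⟨(Finset.range k).image (assignmentCode k a), ?_, ?_, fun c hc => ?_, fun g hg => ?_⟩
  · intro j hj
    obtain ⟨g, hg, rfl⟩ := Finset.mem_image.1 hj
    exact Finset.mem_range.2 (assignmentCode_lt a (Finset.mem_range.1 hg))
  · rw [Finset.card_image_of_injective _ (Function.LeftInverse.injective (group_assignmentCode a)),
      Finset.card_range]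
  · obtain ⟨l, hl, htrue⟩ := ha c hc
    exact ⟨_, mem_image _ (div_groupSize_lt hk l.1), l, hl, (group_assignmentCode a _).symm,
      (testBit_assignmentCode a l.1).trans htrue⟩
  · exact ⟨_, mem_image g hg, group_assignmentCode a g⟩

theorem hasCover_toCover (hk : 0 < k) : (φ.toCover k).HasCover k ↔ φ.Satisfiable := by
  simp only [hasCover_toCover_iff_exists_abscissae, forall_pointAbscissa_iff]
  constructor
  · rintro ⟨S, hSN, hS, hclauses, hgroups⟩
    exact satisfiable_of_codes hk hSN hS hclauses hgroups
  · exact exists_codes_of_satisfiable hk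

end Cover

end CNF

namespace CNF

variable {φ : CNF} {k : ℕ}

section Codes

/-- The part of the encoding of a formula that describes the clause `c`. -/
def clauseCode {n : ℕ} (c : List (Fin n × Bool)) : List ℤ := (c.length : ℤ) :: c.map encodeLiteral

/-- The position in the encoding of `φ` at which clause number `m` begins. -/
def clausePosition (φ : CNF) (m : ℕ) : ℕ := 2 + ((φ.clauses.take m).flatMap clauseCode).length

theorem exists_encode_eq_append_clauseCode {m : ℕ} (hm : m < φ.clauses.length) :
    ∃ u v, φ.encode = u ++ (clauseCode φ.clauses[m] ++ v) ∧ u.length = φ.clausePosition m := by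
  refine ⟨[(φ.numVars : ℤ), φ.clauses.length] ++ (φ.clauses.take m).flatMap clauseCode,
    (φ.clauses.drop (m + 1)).flatMap clauseCode, ?_, by simp +arith [clausePosition]⟩
  have hsplit : φ.clauses = φ.clauses.take m ++ φ.clauses[m] :: φ.clauses.drop (m + 1) := by simp
  calc φ.encode = [(φ.numVars : ℤ), φ.clauses.length] ++ φ.clauses.flatMap clauseCode := rfl
    _ = [(φ.numVars : ℤ), φ.clauses.length] ++
        (φ.clauses.take m ++ φ.clauses[m] :: φ.clauses.drop (m + 1)).flatMap clauseCode := by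
      rw [← hsplit]
    _ = _ := by simp only [List.flatMap_append, List.flatMap_cons, List.append_assoc]

theorem getD_encode_clausePosition_add {m i : ℕ} (hm : m < φ.clauses.length)
    (hi : i ≤ φ.clauses[m].length) :
    φ.encode.getD (φ.clausePosition m + i) 0 = (clauseCode φ.clauses[m]).getD i 0 := by
  obtain ⟨u, v, heq, hu⟩ := exists_encode_eq_append_clauseCode hm
  rw [heq, ← hu, List.getD_append_right _ _ _ _ (Nat.le_add_right _ _), Nat.add_sub_cancel_left,
    List.getD_append _ _ _ _ (by simpa [clauseCode] using Nat.lt_succ_of_le hi)]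

theorem clausePosition_succ {m : ℕ} (hm : m < φ.clauses.length) :
    φ.clausePosition (m + 1) = φ.clausePosition m + (φ.clauses[m].length + 1) := by
  rw [clausePosition, clausePosition, List.take_succ_eq_append_getElem hm]
  simp only [List.flatMap_append, List.flatMap_singleton, List.length_append, clauseCode,
    List.length_cons, List.length_map, add_assoc]

theorem clausePosition_succ_le {m : ℕ} (hm : m < φ.clauses.length) :
    φ.clausePosition (m + 1) ≤ φ.encode.length := by
  obtain ⟨u, v, heq, hu⟩ := exists_encode_eq_append_clauseCode hm
  rw [clausePosition_succ hm, heq, ← hu]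
  simp only [clauseCode, List.length_append, List.length_cons, List.length_map]
  omega

theorem length_clauses_add_two_le : φ.clauses.length + 2 ≤ φ.encode.length := by
  have hle : φ.clauses.length ≤ (φ.clauses.flatMap clauseCode).length := by
    rw [List.length_flatMap]
    simpa using List.card_nsmul_le_sum (φ.clauses.map fun c => (clauseCode c).length) 1
      (by simp [clauseCode])
  exact Nat.add_le_add_right hle 2

/-- The coordinates of the points of the parabola with the given abscissae. -/
def pointsCode (l : List ℤ) : List ℤ := l.flatMap fun x => [x, x * x]

/-- The part of the encoding of the covering instance that describes the polygon with code `j`. -/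
def polygonCode (φ : CNF) (k j : ℕ) : List ℤ :=
  ((φ.clauses.length : ℤ) + 3) :: pointsCode (φ.abscissae k j)

theorem encodePoints_map_onParabola (l : List ℤ) :
    CoverInstance.encodePoints (l.map onParabola) = (l.length : ℤ) :: pointsCode l := by
  simp [CoverInstance.encodePoints, pointsCode, onParabola, List.flatMap_map]

theorem encode_toCover : (φ.toCover k).encode k = [(k : ℤ)] ++ [(φ.numCodes k : ℤ)] ++
    (List.range (φ.numCodes k)).flatMap (φ.polygonCode k) ++ [(φ.numPoints k : ℤ)] ++
    pointsCode ((List.range (φ.numPoints k)).map (φ.pointAbscissa k)) := by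
  have hpolygon (j : ℕ) : CoverInstance.encodePoints ((φ.abscissae k j).map onParabola) =
      φ.polygonCode k j := by
    rw [encodePoints_map_onParabola, length_abscissae, polygonCode]
    norm_cast
  have hpoints : (φ.toCover k).points =
      ((List.range (φ.numPoints k)).map (φ.pointAbscissa k)).map onParabola := by
    simp [toCover]
  rw [CoverInstance.encode, hpoints, encodePoints_map_onParabola]
  simp [toCover, List.flatMap_map, hpolygon]

theorem clauseTrue_take_succ {C : List (Fin φ.numVars × Bool)} {i j : ℕ} (hi : i < C.length) :
    φ.ClauseTrue k j (C.take (i + 1)) ↔ φ.ClauseTrue k j (C.take i) ∨ φ.LiteralTrue k j C[i] := by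
  rw [List.take_succ_eq_append_getElem hi]
  simp only [ClauseTrue, List.mem_append, List.mem_singleton, or_and_right, exists_or,
    exists_eq_left]

end Codes

end CNF

namespace RAM

namespace Translation

/-- The arrays of the program that translates a formula into a covering instance. The `input` and
the `answer` are those of the machine model; the arrays between `outputLength` and `output` hold
intermediate results. -/
inductive Arr where
  | input | answer | powers | outputLength
  | position | truth | code | clause | literal | counter
  | output

/-- The number of an array. -/
def Arr.index (x : Arr) : ℕ := x.ctorIdx

instance : Coe Arr ℕ := ⟨Arr.index⟩

open Arr

@[simp] theorem Arr.index_inj {x y : Arr} : x.index = y.index ↔ x = y := by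
  refine ⟨fun h => ?_, congrArg _⟩
  cases x <;> cases y <;> first | rfl | exact absurd h (by decide)

/-- The state of the memory during the translation of `φ`, when `g` powers of two have been
tabulated and the list `l` has been written to the output. -/
structure State (φ : CNF) (g : ℕ) (l : List ℤ) (s : Store) : Prop where
  input_eq : s input = ofList φ.encode
  answer_eq : s answer = 0
  powers_eq : ∀ i < g, s powers i = 2 ^ i
  outputLength_eq : s outputLength 0 = l.length
  output_eq : s output = ofList l
  unused_eq : ∀ x > output.index, s x = 0

variable {φ : CNF} {g : ℕ} {l : List ℤ} {s : Store} {b R : ℕ} {Q : Store → Prop}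

theorem State.start (φ : CNF) : State φ 0 [] (start φ.encode) where
  input_eq := start_zero _
  answer_eq := start_of_ne_zero _ (by decide)
  powers_eq := by simp
  outputLength_eq := by simp [start_of_ne_zero _ (show outputLength.index ≠ 0 by decide)]
  output_eq := (start_of_ne_zero _ (by decide)).trans ofList_nil.symm
  unused_eq x hx := start_of_ne_zero _ (Nat.ne_zero_of_lt hx)

theorem State.put (hs : State φ g l s) {x : Arr}
    (hx : outputLength.index < x.index ∧ x.index < output.index) (i v : ℤ) :
    State φ g l (s.put x i v) where
  input_eq := by
    rw [Store.put_of_ne _ (ne_of_lt (lt_trans (by decide) hx.1)), hs.input_eq]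
  answer_eq := by
    rw [Store.put_of_ne _ (ne_of_lt (lt_trans (by decide) hx.1)), hs.answer_eq]
  powers_eq := by
    rw [Store.put_of_ne _ (ne_of_lt (lt_trans (by decide) hx.1))]
    exact hs.powers_eq
  outputLength_eq := by rw [Store.put_of_ne _ hx.1.ne, hs.outputLength_eq]
  output_eq := by rw [Store.put_of_ne _ hx.2.ne', hs.output_eq]
  unused_eq y hy := by rw [Store.put_of_ne _ (hx.2.trans hy).ne', hs.unused_eq y hy]

theorem State.put_powers (hs : State φ g l s) : State φ (g + 1) l (s.put powers g (2 ^ g)) where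
  input_eq := by simp [hs.input_eq]
  answer_eq := by simp [hs.answer_eq]
  powers_eq i hi := by
    rw [Store.put_array]
    obtain rfl | hne := eq_or_ne i g
    · simp
    · rw [Function.update_of_ne (by exact_mod_cast hne), hs.powers_eq i (by omega)]
  outputLength_eq := by simp [hs.outputLength_eq]
  output_eq := by simp [hs.output_eq]
  unused_eq x hx := by
    rw [Store.put_of_ne _ (ne_of_gt (lt_trans (by decide) hx)), hs.unused_eq x hx]

section Output

/-- The memory after writing `v` to the output. -/
def emitted (s : Store) (v : ℤ) : Store :=
  (s.put output (s outputLength 0) v).put outputLength 0 (s outputLength 0 + 1)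

@[simp] theorem emitted_of_ne (s : Store) (v : ℤ) {x : ℕ} (h : x ≠ output)
    (h' : x ≠ outputLength) : emitted s v x = s x := by
  simp [emitted, h, h']

theorem State.emitted (hs : State φ g l s) (v : ℤ) : State φ g (l ++ [v]) (emitted s v) where
  input_eq := by simp [hs.input_eq]
  answer_eq := by simp [hs.answer_eq]
  powers_eq := by simpa using hs.powers_eq
  outputLength_eq := by simp [Translation.emitted, hs.outputLength_eq]
  output_eq := by
    rw [Translation.emitted, Store.put_of_ne _ (by simp), Store.put_array, hs.outputLength_eq,
      hs.output_eq, update_ofList]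
  unused_eq x hx := by
    rw [emitted_of_ne _ _ hx.ne' (ne_of_gt (lt_trans (by decide) hx)), hs.unused_eq x hx]

/-- Write the value of `e` to the output. -/
def emit (e : Expr) : Prog :=
  .assign output (reg outputLength) e ;; set outputLength (reg outputLength + 1)

theorem runs_emit {l' : List ℤ} {e : Expr} {v : ℤ} (hs : State φ g l s) (hl' : Fits b l')
    (hl : l ++ [v] <+: l') (he : e.eval s = v) (hQ : Q (emitted s v)) : Runs b R (emit e) s Q := by
  have hlen : ((l.length : ℤ) + 1) ≤ 2 ^ b := by
    have := hl.length_le.trans hl'.1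
    rw [List.length_append, List.length_singleton] at this
    exact_mod_cast this
  refine .seq (.assign (he ▸ hl'.2 v (hl.subset (by simp))) (.set ?_ ?_))
  · simpa [hs.outputLength_eq, abs_of_nonneg (by positivity : (0 : ℤ) ≤ l.length + 1)] using hlen
  · simpa [he, emitted] using hQ

/-- Write the coordinates of the point of the parabola with abscissa `e` to the output. -/
def emitPoint (e : Expr) : Prog :=
  emit e ;; emit (.get output (reg outputLength - 1) * .get output (reg outputLength - 1))

/-- The memory after writing the coordinates of the point of the parabola with abscissa `x` to the
output. -/
def emittedPoint (s : Store) (x : ℤ) : Store := emitted (emitted s x) (x * x)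

@[simp] theorem emittedPoint_of_ne (s : Store) (v : ℤ) {x : ℕ} (h : x ≠ output)
    (h' : x ≠ outputLength) : emittedPoint s v x = s x := by
  simp [emittedPoint, h, h']

theorem State.emittedPoint {u : List ℤ} (hs : State φ g (l ++ CNF.pointsCode u) s) (x : ℤ) :
    State φ g (l ++ CNF.pointsCode (u ++ [x])) (emittedPoint s x) := by
  simpa [CNF.pointsCode, Translation.emittedPoint] using (hs.emitted x).emitted (x * x)

theorem runs_emitPoint {u l' : List ℤ} {e : Expr} {x : ℤ}
    (hs : State φ g (l ++ CNF.pointsCode u) s) (hl' : Fits b l')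
    (hl : l ++ CNF.pointsCode (u ++ [x]) <+: l') (he : e.eval s = x) (hQ : Q (emittedPoint s x)) :
    Runs b R (emitPoint e) s Q := by
  have hxx : l ++ CNF.pointsCode u ++ [x] ++ [x * x] <+: l' := by
    simpa [CNF.pointsCode] using hl
  refine .seq (runs_emit hs hl' ((List.prefix_append _ _).trans hxx) he ?_)
  refine runs_emit (hs.emitted x) hl' hxx ?_ hQ
  simp [emitted]

end Output

end Translation

end RAM

namespace RAM

namespace Translation

open Arr

variable {φ : CNF} {k g j m i : ℕ} {l u l' : List ℤ} {s : Store} {b R : ℕ} {Q : Store → Prop}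

section Expressions

/-- An expression for `φ.groupSize k`. -/
def groupSize (k : ℕ) : Expr := .get input 0 / k + 1

/-- An expression for `2 ^ φ.groupSize k`. -/
def groupPower (k : ℕ) : Expr := .get powers (groupSize k)

/-- An expression for `φ.numCodes k`. -/
def numCodes (k : ℕ) : Expr := k * groupPower k

/-- An expression for the number of clauses. -/
def numClauses : Expr := .get input 1

/-- An expression for `φ.numPoints k`. -/
def numPoints (k : ℕ) : Expr := numClauses + k

/-- An expression for `φ.pointAbscissa k i`. -/
def pointAbscissa (k : ℕ) (i : Expr) : Expr := 2 * i - numPoints k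

/-- An expression for the group of the variables of the partial assignment `code`. -/
def group (k : ℕ) : Expr := reg code / groupPower k

/-- The remainder of `a` modulo `c`. -/
def mod (a c : Expr) : Expr := a - c * (a / c)

/-- A test for equality: it is positive if and only if `a` and `c` have the same value. -/
def equal (a c : Expr) : Expr := 1 - (a - c) * (a - c)

theorem State.input_zero (hs : State φ g l s) : s input 0 = φ.numVars := by
  rw [hs.input_eq]
  rfl

theorem State.input_one (hs : State φ g l s) : s input 1 = φ.clauses.length := by
  rw [hs.input_eq]
  rfl

theorem State.eval_groupSize (hs : State φ g l s) : (groupSize k).eval s = φ.groupSize k := by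
  simp [groupSize, CNF.groupSize, hs.input_zero]

theorem State.eval_numClauses (hs : State φ g l s) : numClauses.eval s = φ.clauses.length := by
  simp [numClauses, hs.input_one]

theorem State.eval_numPoints (hs : State φ g l s) : (numPoints k).eval s = φ.numPoints k := by
  simp [numPoints, CNF.numPoints, hs.eval_numClauses]

theorem State.eval_pointAbscissa (hs : State φ g l s) {e : Expr} (he : e.eval s = i) :
    (pointAbscissa k e).eval s = φ.pointAbscissa k i := by
  simp [pointAbscissa, CNF.pointAbscissa, hs.eval_numPoints, he]

theorem State.eval_groupPower (hs : State φ (φ.groupSize k + 1) l s) :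
    (groupPower k).eval s = 2 ^ φ.groupSize k := by
  rw [groupPower, Expr.eval_get, hs.eval_groupSize, hs.powers_eq _ (Nat.lt_succ_self _)]

theorem State.eval_numCodes (hs : State φ (φ.groupSize k + 1) l s) :
    (numCodes k).eval s = φ.numCodes k := by
  simp [numCodes, CNF.numCodes, hs.eval_groupPower]

theorem State.eval_group (hs : State φ (φ.groupSize k + 1) l s) (hj : s code 0 = j) :
    (group k).eval s = φ.group k j := by
  simp [group, CNF.group, hs.eval_groupPower, hj]

theorem eval_mod (a c : Expr) : (mod a c).eval s = a.eval s % c.eval s :=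
  (Int.emod_def _ _).symm

theorem eval_equal_pos {a c : Expr} : 0 < (equal a c).eval s ↔ a.eval s = c.eval s := by
  simp only [equal, Expr.eval_sub, Expr.eval_mul, Expr.eval_ofNat]
  constructor
  · intro h
    by_contra hne
    have : 0 < (a.eval s - c.eval s) * (a.eval s - c.eval s) :=
      mul_self_pos.2 (sub_ne_zero.2 hne)
    omega
  · rintro h
    simp [h]

end Expressions

section Clauses

/-- Set the register `truth` to `1` if the partial assignment `code` gives the truth value `β` to
the variable `v`. -/
def literalTest (k : ℕ) (v β : Expr) : Prog :=
  .ite (equal (v / groupSize k) (group k))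
    (.ite (equal (mod (reg code / .get powers (mod v (groupSize k))) 2) β) (set truth 1) .skip)
    .skip

/-- The literal at which the registers `position` and `literal` point. -/
def currentLiteral : Expr := .get input (reg position + 1 + reg literal)

/-- Set the register `truth` to `1` if the partial assignment `code` makes the current literal
true. -/
def literalStep (k : ℕ) : Prog :=
  .ite currentLiteral (literalTest k (currentLiteral - 1) 1)
    (literalTest k (0 - currentLiteral - 1) 0)

/-- The length of the clause at which the register `position` points. -/
def clauseLength : Expr := .get input (reg position)

/-- Write the point to the output that represents the clause number `clause` in the polygon number
`code`, and move the register `position` to the next clause. -/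
def clauseStep (k : ℕ) : Prog :=
  set truth 0 ;; forRange literal clauseLength (literalStep k) ;;
    set position (reg position + (clauseLength + 1)) ;;
    emitPoint (pointAbscissa k (reg clause) + (1 - reg truth))

theorem runs_literalTest (hs : State φ (φ.groupSize k + 1) l s) (hj : s code 0 = j)
    {lit : Fin φ.numVars × Bool} {v β : Expr} (hv : v.eval s = lit.1.val)
    (hβ : β.eval s = lit.2.toNat)
    (hQ : Q (if φ.LiteralTrue k j lit then s.put truth 0 1 else s)) :
    Runs b R (literalTest k v β) s Q := by
  have hgroup : 0 < (equal (v / groupSize k) (group k)).eval s ↔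
      lit.1.val / φ.groupSize k = φ.group k j := by
    rw [eval_equal_pos, hs.eval_group hj, Expr.eval_div, hv, hs.eval_groupSize]
    norm_cast
  have hmod : lit.1.val % φ.groupSize k < φ.groupSize k + 1 :=
    (Nat.mod_lt _ (Nat.succ_pos _)).trans (Nat.lt_succ_self _)
  have hbit : 0 < (equal (mod (reg code / .get powers (mod v (groupSize k))) 2) β).eval s ↔
      j.testBit (lit.1.val % φ.groupSize k) = lit.2 := by
    rw [eval_equal_pos, eval_mod, Expr.eval_div, Expr.eval_get, eval_mod, hv, hs.eval_groupSize,
      eval_reg, hj, hβ, ← Int.natCast_emod, hs.powers_eq _ hmod, Expr.eval_ofNat]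
    rw [Nat.testBit_eq_decide_div_mod_eq]
    norm_cast
    cases lit.2 <;> simp
  refine .ite (fun h => .ite (fun h' => .set ?_ ?_) fun h' => .skip ?_) fun h => .skip ?_
  · simpa using one_le_pow₀ (n := b) (one_le_two (α := ℤ))
  · rwa [if_pos ⟨hgroup.1 h, hbit.1 h'⟩] at hQ
  · rwa [if_neg fun htrue => h' (hbit.2 htrue.2)] at hQ
  · rwa [if_neg fun htrue => h (hgroup.2 htrue.1)] at hQ

theorem State.eval_clauseLength (hs : State φ g l s) (hm : m < φ.clauses.length)
    (hpos : s position 0 = φ.clausePosition m) :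
    clauseLength.eval s = φ.clauses[m].length := by
  rw [clauseLength, Expr.eval_get, eval_reg, hpos, hs.input_eq, ofList_natCast]
  exact CNF.getD_encode_clausePosition_add hm (Nat.zero_le _)

theorem State.eval_currentLiteral (hs : State φ g l s) (hm : m < φ.clauses.length)
    (hi : i < φ.clauses[m].length) (hpos : s position 0 = φ.clausePosition m)
    (hlit : s literal 0 = i) :
    currentLiteral.eval s = CNF.encodeLiteral φ.clauses[m][i] := by
  have hindex : (reg position + 1 + reg literal).eval s = ↑(φ.clausePosition m + (i + 1)) := by
    simp only [Expr.eval_add, eval_reg, Expr.eval_ofNat, hpos, hlit]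
    push_cast
    ring
  rw [currentLiteral, Expr.eval_get, hindex, hs.input_eq, ofList_natCast,
    CNF.getD_encode_clausePosition_add hm hi, CNF.clauseCode, List.getD_cons_succ,
    List.getD_eq_getElem _ _ (by rwa [List.length_map]), List.getElem_map]

theorem runs_literalStep (hs : State φ (φ.groupSize k + 1) l s) (hj : s code 0 = j)
    {lit : Fin φ.numVars × Bool} (hlit : currentLiteral.eval s = CNF.encodeLiteral lit)
    (hQ : Q (if φ.LiteralTrue k j lit then s.put truth 0 1 else s)) :
    Runs b R (literalStep k) s Q := by
  cases hsign : lit.2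
  · have hval : currentLiteral.eval s = -((lit.1 : ℕ) + 1) := by
      rw [hlit, CNF.encodeLiteral, hsign, if_neg Bool.false_ne_true]
    refine .ite (fun h => absurd h (by omega)) fun _ => runs_literalTest hs hj ?_ ?_ hQ
    · simp [hval]
    · simp [hsign]
  · have hval : currentLiteral.eval s = (lit.1 : ℕ) + 1 := by
      rw [hlit, CNF.encodeLiteral, hsign, if_pos rfl]
    refine .ite (fun _ => runs_literalTest hs hj ?_ ?_ hQ) fun h => absurd h (by omega)
    · simp [hval]
    · simp [hsign]

theorem runs_clauseStep (hs : State φ (φ.groupSize k + 1) (l ++ CNF.pointsCode u) s)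
    (hj : s code 0 = j) (hm : m < φ.clauses.length) (hclause : s clause 0 = m)
    (hpos : s position 0 = φ.clausePosition m) (hin : Fits b φ.encode) (hl' : Fits b l')
    (hl : l ++ CNF.pointsCode (u ++ [φ.clauseAbscissa k j m]) <+: l') :
    Runs b (φ.encode.length * R) (clauseStep k) s fun s' =>
      State φ (φ.groupSize k + 1) (l ++ CNF.pointsCode (u ++ [φ.clauseAbscissa k j m])) s' ∧
        s' code 0 = j ∧ s' clause 0 = m ∧ s' position 0 = φ.clausePosition (m + 1) := by
  have hle : φ.clauses[m].length < φ.encode.length := by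
    have := CNF.clausePosition_succ hm
    have := CNF.clausePosition_succ_le hm
    omega
  have hsucc : (φ.clausePosition m : ℤ) + (φ.clauses[m].length + 1) = φ.clausePosition (m + 1) := by
    exact_mod_cast (CNF.clausePosition_succ hm).symm
  refine .seq (.set (by simp) (.seq (.forRange (n := φ.clauses[m].length) (fun i s =>
    State φ (φ.groupSize k + 1) (l ++ CNF.pointsCode u) s ∧ s code 0 = j ∧ s clause 0 = m ∧
      s position 0 = φ.clausePosition m ∧
      s truth 0 = if φ.ClauseTrue k j (φ.clauses[m].take i) then 1 else 0) hle
    (by exact_mod_cast hle.le.trans hin.1) ?_ ?_ ?_ ?_ ?_)))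
  · rintro i s v ⟨hs, hcode, hclause, hpos, htruth⟩
    exact ⟨hs.put (by decide) _ _, by simpa, by simpa, by simpa, by simpa⟩
  · rintro i s ⟨hs, -, -, hpos, -⟩
    exact hs.eval_clauseLength hm hpos
  · refine ⟨hs.put (by decide) _ _, ?_⟩
    simp [hj, hclause, hpos, CNF.ClauseTrue]
  · rintro i hi s ⟨hs, hcode, hclause, hpos, htruth⟩ hlit
    refine runs_literalStep hs hcode (hs.eval_currentLiteral hm hi hpos hlit) ?_
    simp only [CNF.clauseTrue_take_succ hi]
    by_cases h : φ.LiteralTrue k j φ.clauses[m][i]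
    · simp only [h, or_true, if_true]
      exact ⟨⟨hs.put (by decide) _ _, by simpa, by simpa, by simpa, by simp⟩, by simpa⟩
    · simp only [h, or_false, if_false]
      exact ⟨⟨hs, hcode, hclause, hpos, htruth⟩, hlit⟩
  · rintro s ⟨hs, hcode, hclause, hpos, htruth⟩
    have heval : (reg position + (clauseLength + 1)).eval s = φ.clausePosition (m + 1) := by
      rw [← hsucc, ← hpos, ← hs.eval_clauseLength hm hpos]
      rfl
    refine .seq (.set ?_ (runs_emitPoint (hs.put (by decide) _ _) hl' hl ?_ ?_))
    · rw [heval, Nat.abs_cast]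
      exact_mod_cast (CNF.clausePosition_succ_le hm).trans hin.1
    · rw [Expr.eval_add, (hs.put (by decide) _ _).eval_pointAbscissa (by simpa using hclause)]
      rw [List.take_length] at htruth
      rw [Expr.eval_sub, Expr.eval_ofNat, eval_reg, Store.put_of_ne _ (by decide), htruth,
        CNF.clauseAbscissa, List.getD_eq_getElem _ _ hm]
      split_ifs <;> rfl
    · exact ⟨(hs.put (by decide) _ _).emittedPoint _, by simpa, by simpa, by simp [heval]⟩

end Clauses

end Translation

end RAM

namespace RAM

namespace Translation

open Arr

variable {φ : CNF} {k g j : ℕ} {l l' : List ℤ} {s : Store} {b R N : ℕ}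

/-- Write the polygon with number `code` to the output. -/
def polygonStep (k : ℕ) : Prog :=
  emit (numClauses + 3) ;; emitPoint (0 - numPoints k - 1) ;; set position 2 ;;
    forRange clause numClauses (clauseStep k) ;;
    emitPoint (pointAbscissa k (numClauses + group k)) ;; emitPoint (numPoints k + reg code)

/-- Tabulate the powers of two. -/
def setup (k : ℕ) : Prog :=
  .assign powers 0 1 ;;
    forRange counter (groupSize k)
      (.assign powers (reg counter + 1) (2 * .get powers (reg counter)))

/-- The translation of a formula into a covering instance. -/
def translate (k : ℕ) : Prog :=
  setup k ;; emit k ;; emit (numCodes k) ;; forRange code (numCodes k) (polygonStep k) ;;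
    emit (numPoints k) ;; forRange counter (numPoints k) (emitPoint (pointAbscissa k (reg counter)))

theorem range_prefix_range {m n : ℕ} (h : m ≤ n) : List.range m <+: List.range n := by
  obtain ⟨d, rfl⟩ := Nat.exists_eq_add_of_le h
  rw [List.range_add]
  exact List.prefix_append _ _

theorem runs_clauses {u : List ℤ} (hs : State φ (φ.groupSize k + 1) (l ++ CNF.pointsCode u) s)
    (hj : s code 0 = j) (hpos : s position 0 = 2) (hin : Fits b φ.encode) (hl' : Fits b l')
    (hl : l ++ CNF.pointsCode (u ++ (List.range φ.clauses.length).map (φ.clauseAbscissa k j)) <+: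
      l') :
    Runs b (φ.encode.length * (φ.encode.length * R)) (forRange clause numClauses (clauseStep k)) s
      fun s' => State φ (φ.groupSize k + 1)
        (l ++ CNF.pointsCode (u ++ (List.range φ.clauses.length).map (φ.clauseAbscissa k j))) s' ∧
          s' code 0 = j := by
  have hlt : φ.clauses.length < φ.encode.length := by
    have := φ.length_clauses_add_two_le
    omega
  refine .forRange (n := φ.clauses.length) (fun m s => State φ (φ.groupSize k + 1)
    (l ++ CNF.pointsCode (u ++ (List.range m).map (φ.clauseAbscissa k j))) s ∧ s code 0 = j ∧
      s position 0 = φ.clausePosition m) hlt (by exact_mod_cast hlt.le.trans hin.1) ?_ ?_ ?_ ?_ ?_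
  · rintro m s v ⟨hs, hj, hpos⟩
    exact ⟨hs.put (by decide) _ _, by simpa, by simpa⟩
  · exact fun m s hs => hs.1.eval_numClauses
  · exact ⟨by simpa using hs, hj, hpos⟩
  · rintro m hm s ⟨hs, hj, hpos⟩ hclause
    have hsucc : u ++ (List.range (m + 1)).map (φ.clauseAbscissa k j) =
        u ++ (List.range m).map (φ.clauseAbscissa k j) ++ [φ.clauseAbscissa k j m] := by
      rw [List.range_succ, List.map_append, List.map_singleton, List.append_assoc]
    have hprefix : l ++ CNF.pointsCode
        (u ++ (List.range (m + 1)).map (φ.clauseAbscissa k j)) <+: l' :=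
      ((List.prefix_append_right_inj l).2 (.flatMap ((List.prefix_append_right_inj u).2
        ((range_prefix_range hm).map _)) _)).trans hl
    rw [hsucc] at hprefix ⊢
    exact (runs_clauseStep hs hj hm hclause hpos hin hl' hprefix).mono
      fun s' ⟨hs', hj', hclause', hpos'⟩ => ⟨⟨hs', hj', hpos'⟩, hclause'⟩
  · rintro s ⟨hs, hj, -⟩
    exact ⟨hs, hj⟩

theorem runs_polygonStep (hs : State φ (φ.groupSize k + 1) l s) (hj : s code 0 = j)
    (hin : Fits b φ.encode) (hl' : Fits b l') (hl : l ++ φ.polygonCode k j <+: l') :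
    Runs b (φ.encode.length * (φ.encode.length * R)) (polygonStep k) s fun s' =>
      State φ (φ.groupSize k + 1) (l ++ φ.polygonCode k j) s' ∧ s' code 0 = j := by
  have hpolygon : l ++ φ.polygonCode k j =
      l ++ [(φ.clauses.length : ℤ) + 3] ++ CNF.pointsCode (φ.abscissae k j) := by
    simp [CNF.polygonCode]
  rw [hpolygon] at hl ⊢
  have hprefix (v v' : List ℤ) (hv : v ++ v' = φ.abscissae k j) :
      l ++ [(φ.clauses.length : ℤ) + 3] ++ CNF.pointsCode v <+: l' :=
    ((List.prefix_append_right_inj _).2 (.flatMap ⟨v', hv⟩ _)).trans hl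
  have htwo : (2 : ℤ) ≤ 2 ^ b := by
    have h2 : 2 ≤ φ.encode.length := Nat.le_add_left _ _
    exact_mod_cast h2.trans hin.1
  have hs₁ : State φ (φ.groupSize k + 1) (l ++ [(φ.clauses.length : ℤ) + 3] ++ CNF.pointsCode [])
      (emitted s (φ.clauses.length + 3)) := by
    simpa [CNF.pointsCode] using hs.emitted (φ.clauses.length + 3)
  have hs₂ := (hs₁.emittedPoint (-(φ.numPoints k : ℤ) - 1)).put (x := position) (by decide) 0 2
  refine .seq (runs_emit hs hl' ((List.prefix_append _ _).trans hl)
    (by simp [hs.eval_numClauses]) ?_)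
  refine .seq (runs_emitPoint hs₁ hl' (hprefix _ _ (List.append_assoc _ _ _))
    (by simp [hs₁.eval_numPoints]) ?_)
  refine .seq (.set (by simpa using htwo) (.seq ((runs_clauses hs₂ (by simpa) (by simp) hin hl'
    (hprefix _ _ (List.append_assoc _ _ _).symm)).mono ?_)))
  rintro s₃ ⟨hs₃, hj₃⟩
  have hs₄ := hs₃.emittedPoint (φ.pointAbscissa k (φ.clauses.length + φ.group k j))
  refine .seq (runs_emitPoint hs₃ hl' (hprefix _ _ rfl)
    (hs₃.eval_pointAbscissa (by simp [hs₃.eval_numClauses, hs₃.eval_group hj₃])) ?_)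
  refine runs_emitPoint hs₄ hl' (hprefix _ [] (List.append_nil _))
    (by simp [hs₄.eval_numPoints, hj₃]) ?_
  exact ⟨hs₄.emittedPoint _, by simpa⟩

theorem runs_setup (hs : State φ 0 [] s) (hN : φ.groupSize k < N)
    (hb : 2 ^ φ.groupSize k ≤ 2 ^ b) :
    Runs b (N * R) (setup k) s (State φ (φ.groupSize k + 1) []) := by
  have hpow {i : ℕ} (hi : i ≤ φ.groupSize k) : |(2 : ℤ) ^ i| ≤ 2 ^ b := by
    rw [abs_of_pos (by positivity)]
    exact_mod_cast (Nat.pow_le_pow_right two_pos hi).trans hb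
  refine .seq (.assign (hpow (Nat.zero_le _)) (.forRange (n := φ.groupSize k)
    (fun i s => State φ (i + 1) [] s) hN ?_ (fun _ _ _ hs => hs.put (by decide) _ _)
    (fun _ _ hs => hs.eval_groupSize) hs.put_powers ?_ fun _ hs => hs))
  · exact_mod_cast Nat.lt_two_pow_self.le.trans hb
  · intro i hi s hs hcounter
    have hindex : (reg counter + 1).eval s = ↑(i + 1) := by simp [hcounter]
    have hvalue : (2 * Expr.get powers (reg counter)).eval s = 2 ^ (i + 1) := by
      simp [hcounter, hs.powers_eq i (Nat.lt_succ_self i), pow_succ']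
    refine .assign (hvalue ▸ hpow hi) ?_
    rw [hindex, hvalue]
    exact ⟨hs.put_powers, by simpa using hcounter⟩

theorem runs_polygons (hs : State φ (φ.groupSize k + 1) l s) (hin : Fits b φ.encode)
    (hl' : Fits b l') (hl : l ++ (List.range (φ.numCodes k)).flatMap (φ.polygonCode k) <+: l')
    (hN : φ.numCodes k < N) (hb : φ.numCodes k ≤ 2 ^ b) :
    Runs b (N * (φ.encode.length * (φ.encode.length * R)))
      (forRange code (numCodes k) (polygonStep k)) s (State φ (φ.groupSize k + 1)
        (l ++ (List.range (φ.numCodes k)).flatMap (φ.polygonCode k))) := by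
  refine .forRange (n := φ.numCodes k) (fun j s => State φ (φ.groupSize k + 1)
    (l ++ (List.range j).flatMap (φ.polygonCode k)) s) hN (by exact_mod_cast hb)
    (fun _ _ _ hs => hs.put (by decide) _ _) (fun _ _ hs => hs.eval_numCodes) (by simpa using hs)
    ?_ fun _ hs => hs
  intro j hj s hs hcode
  have hsucc : l ++ (List.range (j + 1)).flatMap (φ.polygonCode k) =
      l ++ (List.range j).flatMap (φ.polygonCode k) ++ φ.polygonCode k j := by
    simp [List.range_succ]
  have hprefix : l ++ (List.range (j + 1)).flatMap (φ.polygonCode k) <+: l' :=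
    ((List.prefix_append_right_inj l).2 ((range_prefix_range hj).flatMap _)).trans hl
  rw [hsucc] at hprefix ⊢
  exact runs_polygonStep hs hcode hin hl' hprefix

theorem runs_points (hs : State φ g l s) (hl' : Fits b l')
    (hl : l ++ CNF.pointsCode ((List.range (φ.numPoints k)).map (φ.pointAbscissa k)) <+: l')
    (hN : φ.numPoints k < N) (hb : φ.numPoints k ≤ 2 ^ b) :
    Runs b (N * R) (forRange counter (numPoints k) (emitPoint (pointAbscissa k (reg counter)))) s
      (State φ g (l ++ CNF.pointsCode ((List.range (φ.numPoints k)).map (φ.pointAbscissa k)))) := by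
  refine .forRange (n := φ.numPoints k) (fun i s => State φ g
    (l ++ CNF.pointsCode ((List.range i).map (φ.pointAbscissa k))) s) hN (by exact_mod_cast hb)
    (fun _ _ _ hs => hs.put (by decide) _ _) (fun _ _ hs => hs.eval_numPoints)
    (by simpa [CNF.pointsCode] using hs) ?_ fun _ hs => hs
  intro i hi s hs hcounter
  have hsucc : (List.range (i + 1)).map (φ.pointAbscissa k) =
      (List.range i).map (φ.pointAbscissa k) ++ [φ.pointAbscissa k i] := by
    simp [List.range_succ]
  have hprefix : l ++ CNF.pointsCode ((List.range (i + 1)).map (φ.pointAbscissa k)) <+: l' :=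
    ((List.prefix_append_right_inj l).2 (((range_prefix_range hi).map _).flatMap _)).trans hl
  rw [hsucc] at hprefix ⊢
  exact runs_emitPoint hs hl' hprefix (hs.eval_pointAbscissa hcounter)
    ⟨hs.emittedPoint _, by simpa using hcounter⟩

theorem runs_translate (hk : 1 ≤ k) (hin : Fits b φ.encode)
    (hout : Fits b ((φ.toCover k).encode k)) :
    Runs b (((φ.toCover k).card + 1) * (φ.encode.length * (φ.encode.length * R))) (translate k)
      (start φ.encode) (State φ (φ.groupSize k + 1) ((φ.toCover k).encode k)) := by
  have hpow : 2 ^ φ.groupSize k ≤ φ.numCodes k := Nat.le_mul_of_pos_left _ hk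
  have hle {n : ℕ} (hn : (n : ℤ) ∈ (φ.toCover k).encode k) : n ≤ 2 ^ b := by
    exact_mod_cast (le_abs_self _).trans (hout.2 _ hn)
  have hN : φ.numCodes k ≤ 2 ^ b := hle (by simp [CNF.encode_toCover])
  have hD : φ.numPoints k ≤ 2 ^ b := hle (by simp [CNF.encode_toCover])
  rw [CNF.card_toCover]
  rw [CNF.encode_toCover] at hout ⊢
  refine .seq ((runs_setup (.start φ) (by have := Nat.lt_two_pow_self (n := φ.groupSize k); omega)
    (hpow.trans hN)).mono fun s₁ hs₁ => ?_)
  have hs₂ := hs₁.emitted k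
  refine .seq (runs_emit hs₁ hout ?_ (by simp) (.seq (runs_emit hs₂ hout ?_ hs₂.eval_numCodes
    (.seq ((runs_polygons (hs₂.emitted _) hin hout ?_ (by omega) hN).mono fun s₃ hs₃ => ?_)))))
  · exact ((List.prefix_append _ _).trans (List.prefix_append _ _)).trans
      ((List.prefix_append _ _).trans (List.prefix_append _ _))
  · exact ((List.prefix_append _ _).trans (List.prefix_append _ _)).trans (List.prefix_append _ _)
  · exact (List.prefix_append _ _).trans (List.prefix_append _ _)
  refine .seq (runs_emit hs₃ hout (List.prefix_append _ _) hs₃.eval_numPoints ?_)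
  exact runs_points (hs₃.emitted _) hout (List.prefix_refl _) (by omega) hD

end Translation

end RAM

theorem CoverInstance.Compact.fits_encode {I : CoverInstance} {k b : ℕ} (hI : I.Compact)
    (hk : k ≤ I.card) (hb : 2 * I.card + 3 ≤ 2 ^ b) : RAM.Fits (2 * b) (I.encode k) := by
  have hsq : (2 * I.card + 3) ^ 2 ≤ 2 ^ (2 * b) := by
    rw [mul_comm 2 b, pow_mul]
    exact Nat.pow_le_pow_left hb 2
  refine ⟨(hI.length_encode_le k).trans hsq, fun z hz => (hI.abs_le_of_mem_encode hz).trans ?_⟩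
  exact_mod_cast (max_le (by nlinarith) (by nlinarith) : max k (I.card ^ 2) ≤ _).trans hsq

namespace CNF

variable {φ : CNF} {k : ℕ}

section Size

variable (φ) in
theorem length_encode_add_numVars : φ.encode.length + φ.numVars = φ.size + 2 := by
  simp only [encode, size, List.length_cons, List.length_flatMap, List.length_map]
  omega

theorem length_add_one_le_size {c : List (Fin φ.numVars × Bool)} (hc : c ∈ φ.clauses) :
    φ.numVars + (c.length + 1) ≤ φ.size :=
  Nat.add_le_add_left (List.le_sum_of_mem
    (List.mem_map_of_mem (f := fun c : List (Fin φ.numVars × Bool) => c.length + 1) hc)) _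

theorem length_clauses_le_size : φ.clauses.length ≤ φ.size := by
  have := φ.length_clauses_add_two_le
  have := φ.length_encode_add_numVars
  omega

theorem abs_le_size_of_mem_encode {z : ℤ} (hz : z ∈ φ.encode) : |z| ≤ φ.size := by
  simp only [encode, List.mem_cons, List.mem_flatMap, List.mem_map] at hz
  obtain rfl | rfl | ⟨c, hc, rfl | ⟨l, -, rfl⟩⟩ := hz
  · rw [Nat.abs_cast]
    exact_mod_cast Nat.le_add_right _ _
  · rw [Nat.abs_cast]
    exact_mod_cast length_clauses_le_size
  · rw [Nat.abs_cast]
    exact_mod_cast (by have := length_add_one_le_size hc; omega : c.length ≤ φ.size)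
  · have := length_add_one_le_size hc
    have := l.1.isLt
    rw [encodeLiteral, abs_le]
    split_ifs <;> omega

theorem fits_encode {b : ℕ} (hb : φ.size + 2 ≤ 2 ^ b) : RAM.Fits b φ.encode := by
  refine ⟨by have := φ.length_encode_add_numVars; omega,
    fun z hz => (abs_le_size_of_mem_encode hz).trans ?_⟩
  exact_mod_cast (Nat.le_add_right _ _).trans hb

variable (φ k) in
/-- A number of bits that suffices for all numbers that occur in the translation of `φ`. -/
def bits : ℕ := 2 * (φ.groupSize k + φ.size + k + 3)

theorem two_mul_card_add_three_le :
    2 * (φ.toCover k).card + 3 ≤ 2 ^ (φ.groupSize k + φ.size + k + 3) := by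
  have hG : 1 ≤ 2 ^ φ.groupSize k := Nat.one_le_two_pow
  have hZ : φ.size + 1 ≤ 2 ^ φ.size := Nat.lt_two_pow_self
  have hK : k + 1 ≤ 2 ^ k := Nat.lt_two_pow_self
  have hM := length_clauses_le_size (φ := φ)
  rw [card_toCover, numCodes, numPoints, pow_add, pow_add, pow_add]
  generalize 2 ^ φ.groupSize k = G at *
  generalize 2 ^ φ.size = Z at *
  generalize 2 ^ k = K at *
  have hGZ : G + Z ≤ G * Z + 1 := by nlinarith
  nlinarith [Nat.mul_le_mul hGZ hK]

theorem fits_encode_bits : RAM.Fits (φ.bits k) φ.encode := by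
  refine fits_encode ?_
  have hZ : φ.size + 1 ≤ 2 ^ φ.size := Nat.lt_two_pow_self
  calc φ.size + 2 ≤ 2 ^ (φ.size + 1) := by omega
    _ ≤ 2 ^ φ.bits k := Nat.pow_le_pow_right two_pos (by unfold bits; omega)

theorem fits_encode_toCover (hk : 1 ≤ k) :
    RAM.Fits (φ.bits k) ((φ.toCover k).encode k) := by
  refine (compact_toCover hk).fits_encode ?_ two_mul_card_add_three_le
  rw [card_toCover, numPoints]
  omega

end Size

section RunningTime

theorem one_le_card_toCover (hk : 1 ≤ k) : 1 ≤ (φ.toCover k).card := by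
  rw [card_toCover, numPoints]
  omega

theorem card_toCover_lt :
    (φ.toCover k).card < (3 * k + 1) * (2 ^ (φ.numVars / k) * (φ.size + 1)) := by
  have hE : 1 ≤ 2 ^ (φ.numVars / k) := Nat.one_le_two_pow
  have hM := length_clauses_le_size (φ := φ)
  rw [card_toCover, numCodes, numPoints, groupSize, pow_succ]
  generalize 2 ^ (φ.numVars / k) = E at *
  have hES : E + φ.size ≤ E * (φ.size + 1) := by nlinarith
  nlinarith [Nat.mul_le_mul_left k hES]

theorem bits_mul_card_mul_length_sq_le :
    φ.bits k * (((φ.toCover k).card + 1) * (φ.encode.length * φ.encode.length)) ≤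
      (2 * k + 8) * (3 * k + 1) * 4 * (2 ^ (φ.numVars / k) * (φ.size + 1) ^ 4) := by
  have hbits : φ.bits k ≤ (2 * k + 8) * (φ.size + 1) := by
    have hg : φ.groupSize k ≤ φ.size + 1 :=
      Nat.succ_le_succ ((Nat.div_le_self _ _).trans (Nat.le_add_right _ _))
    unfold bits
    nlinarith
  have hlen : φ.encode.length ≤ 2 * (φ.size + 1) := by
    have := φ.length_encode_add_numVars
    omega
  calc φ.bits k * (((φ.toCover k).card + 1) * (φ.encode.length * φ.encode.length))
      ≤ (2 * k + 8) * (φ.size + 1) * ((3 * k + 1) * (2 ^ (φ.numVars / k) * (φ.size + 1)) *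
          (2 * (φ.size + 1) * (2 * (φ.size + 1)))) := by
        gcongr
        exact card_toCover_lt
    _ = _ := by ring

theorem two_pow_div_rpow_le (n k : ℕ) {r : ℝ} (hr : 0 ≤ r) :
    ((2 : ℝ) ^ (n / k)) ^ r ≤ (2 ^ (r / k)) ^ n := by
  rw [← Real.rpow_natCast, ← Real.rpow_natCast, ← Real.rpow_mul two_pos.le,
    ← Real.rpow_mul two_pos.le]
  refine Real.rpow_le_rpow_of_exponent_le one_le_two ?_
  calc ((n / k : ℕ) : ℝ) * r ≤ n / k * r := by gcongr; exact Nat.cast_div_le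
    _ = r / k * n := by ring

theorem two_pow_div_le (n k : ℕ) {r : ℝ} (hr : 1 ≤ r) : (2 : ℝ) ^ (n / k) ≤ (2 ^ (r / k)) ^ n :=
  calc (2 : ℝ) ^ (n / k) ≤ ((2 : ℝ) ^ (n / k)) ^ r :=
        Real.self_le_rpow_of_one_le (one_le_pow₀ one_le_two) hr
    _ ≤ _ := two_pow_div_rpow_le n k (zero_le_one.trans hr)

theorem mul_rpow_card_toCover_le {C p r : ℝ} (hk : 1 ≤ k) (hp : p ≤ r) (hr : 0 ≤ r)
    (hrk : r ≤ k) :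
    C * ((φ.toCover k).card : ℝ) ^ p ≤
      |C| * (3 * k + 1) ^ k * ((2 ^ (r / k)) ^ φ.numVars * ((φ.size : ℝ) + 1) ^ k) := by
  have hcard : 1 ≤ (φ.toCover k).card := one_le_card_toCover hk
  have hlt : ((φ.toCover k).card : ℝ) ≤
      (3 * k + 1) * (2 ^ (φ.numVars / k) * ((φ.size : ℝ) + 1)) := by
    exact_mod_cast card_toCover_lt.le
  have rpow_le_pow {y : ℝ} (hy : 1 ≤ y) : y ^ r ≤ y ^ k := by
    rw [← Real.rpow_natCast]
    exact Real.rpow_le_rpow_of_exponent_le hy hrk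
  calc C * ((φ.toCover k).card : ℝ) ^ p
      ≤ |C| * ((φ.toCover k).card : ℝ) ^ r := by
        refine mul_le_mul (le_abs_self C) ?_ (by positivity) (abs_nonneg C)
        exact Real.rpow_le_rpow_of_exponent_le (by exact_mod_cast hcard) hp
    _ ≤ |C| * ((3 * k + 1) * (2 ^ (φ.numVars / k) * ((φ.size : ℝ) + 1))) ^ r := by gcongr
    _ = |C| * (3 * k + 1) ^ r * ((2 ^ (φ.numVars / k)) ^ r * ((φ.size : ℝ) + 1) ^ r) := by
        rw [Real.mul_rpow (by positivity) (by positivity),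
          Real.mul_rpow (by positivity) (by positivity), mul_assoc]
    _ ≤ |C| * (3 * k + 1) ^ k * ((2 ^ (r / k)) ^ φ.numVars * ((φ.size : ℝ) + 1) ^ k) := by
        gcongr
        · exact rpow_le_pow (by simp)
        · exact two_pow_div_rpow_le _ _ hr
        · exact rpow_le_pow (by simp)

end RunningTime

end CNF

namespace RAM

namespace Translation

open Arr

variable {φ : CNF} {k : ℕ}

/-- The renaming of the arrays that makes the output of the translation the input of the next
program and leaves the answer in its place. -/
def relocate (x : ℕ) : ℕ := if x = 1 then 1 else output.index + x

theorem relocate_injective : Function.Injective relocate := by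
  intro x y h
  have houtput : 1 < output.index := by decide
  unfold relocate at h
  split_ifs at h <;> omega

theorem State.apply_relocate {g : ℕ} {l : List ℤ} {s : Store} (hs : State φ g l s) (x : ℕ) :
    s (relocate x) = RAM.start l x := by
  obtain rfl | hx1 := eq_or_ne x 1
  · exact hs.answer_eq.trans (start_of_ne_zero l one_ne_zero).symm
  rw [relocate, if_neg hx1]
  obtain rfl | hx := eq_or_ne x 0
  · exact hs.output_eq.trans (start_zero l).symm
  · rw [start_of_ne_zero l hx, hs.unused_eq _ (by omega)]

/-- The constant, depending on `k` only, in the bound for the running time of the translation. -/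
def timeConst (k : ℕ) : ℕ := (2 * k + 8) * (3 * k + 1) * 4 * (translate k).weight

theorem decidesWithin_satisfiable {A : Prog} {T : ℝ} (hk : 1 ≤ k)
    (hA : DecidesWithin A ((φ.toCover k).encode k) ((φ.toCover k).HasCover k) T) :
    DecidesWithin (.seq (translate k) (A.rename relocate)) φ.encode φ.Satisfiable
      (timeConst k * (2 ^ (φ.numVars / k) * ((φ.size : ℝ) + 1) ^ 4) + T) := by
  rw [CNF.hasCover_toCover hk] at hA
  have hlen : 0 < φ.encode.length := Nat.succ_pos _
  obtain ⟨t, s, hexec, ht, -, hs⟩ := runs_translate (R := 1) hk CNF.fits_encode_bits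
    (CNF.fits_encode_toCover hk) (by unfold CNF.bits; omega)
    (Nat.mul_pos (Nat.succ_pos _) (Nat.mul_pos hlen (Nat.mul_pos hlen one_pos)))
    (bounded_start CNF.fits_encode_bits)
  have htime : t ≤ timeConst k * (2 ^ (φ.numVars / k) * (φ.size + 1) ^ 4) := by
    rw [mul_one] at ht
    refine ht.trans ((Nat.mul_le_mul_right _ CNF.bits_mul_card_mul_length_sq_le).trans_eq ?_)
    rw [timeConst]
    ring
  exact (hA.seq_rename relocate_injective rfl hexec hs.apply_relocate).mono
    (add_le_add_left (by exact_mod_cast htime) T)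

end Translation

end RAM

theorem mainTheorem11_general (hSETH : SETH) {k : ℕ} (hk : 2 ≤ k) :
    ¬ ∃ (C ε : ℝ) (A : RAM.Prog), 0 < ε ∧ ∀ I : CoverInstance, 1 ≤ I.card → I.Compact →
      RAM.DecidesWithin A (I.encode k) (I.HasCover k) (C * (I.card : ℝ) ^ ((k : ℝ) - ε)) := by
  rintro ⟨C, ε, A, hε, hA⟩
  have hk1 : 1 ≤ k := by omega
  obtain ⟨r, hεr, hr1, hrk⟩ : ∃ r : ℝ, (k : ℝ) - ε ≤ r ∧ 1 ≤ r ∧ r < k := by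
    have hk2 : (2 : ℝ) ≤ k := by exact_mod_cast hk
    exact ⟨max (k - ε) 1, le_max_left _ _, le_max_right _ _, max_lt (by linarith) (by linarith)⟩
  set x : ℝ := 2 ^ (r / k)
  have hx1 : 1 < x := Real.one_lt_rpow one_lt_two (by positivity)
  have hx2 : x < 2 := by
    conv_rhs => rw [← Real.rpow_one 2]
    exact Real.rpow_lt_rpow_of_exponent_lt one_lt_two ((div_lt_one (by linarith)).2 hrk)
  refine hSETH (2 - x) (by linarith) (by linarith)
    ⟨.seq (RAM.Translation.translate k) (A.rename RAM.Translation.relocate),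
      RAM.Translation.timeConst k + |C| * (3 * k + 1) ^ k, k + 4, fun φ => ?_⟩
  refine (RAM.Translation.decidesWithin_satisfiable hk1
    (hA _ (CNF.one_le_card_toCover hk1) (CNF.compact_toCover hk1))).mono ?_
  have hS : 1 ≤ (φ.size : ℝ) + 1 := by simp
  calc _ ≤ RAM.Translation.timeConst k * (x ^ φ.numVars * ((φ.size : ℝ) + 1) ^ (k + 4)) +
        |C| * (3 * k + 1) ^ k * (x ^ φ.numVars * ((φ.size : ℝ) + 1) ^ (k + 4)) := by
        refine add_le_add ?_ ((CNF.mul_rpow_card_toCover_le hk1 hεr (by linarith) hrk.le).trans ?_)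
        · gcongr
          · exact CNF.two_pow_div_le _ _ hr1
          · omega
        · gcongr
          omega
    _ = _ := by rw [sub_sub_cancel]; ring

/-- Assuming SETH: no algorithm decides in time `f(k) * (|Obj| + |P|)^(k - ε)` whether `k` of the
given convex polygons cover the given points. Moreover, this holds for every fixed `k ≥ 3`, and
already for the instances of moderate description size, in which every polygon has at most
`|Obj| + |P|` vertices and coordinates are at most `(|Obj| + |P|)^2` (so that the whole
input is shorter than the excluded running time when `ε` is small). -/
theorem mainTheorem11 (hSETH : SETH) :
    (¬ ∃ (f : ℕ → ℕ) (ε : ℝ) (A : RAM.Prog), Computable f ∧ 0 < ε ∧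
      ∀ (k : ℕ) (I : CoverInstance), 1 ≤ k → 1 ≤ I.card →
        RAM.DecidesWithin A (I.encode k) (I.HasCover k)
          ((f k : ℝ) * (I.card : ℝ) ^ ((k : ℝ) - ε))) ∧
    (∀ k : ℕ, 3 ≤ k → ¬ ∃ (C ε : ℝ) (A : RAM.Prog), 0 < ε ∧
      ∀ I : CoverInstance, 1 ≤ I.card → I.Compact →
        RAM.DecidesWithin A (I.encode k) (I.HasCover k)
          (C * (I.card : ℝ) ^ ((k : ℝ) - ε))) := by
  refine ⟨?_, fun k hk => mainTheorem11_general hSETH (by omega)⟩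
  rintro ⟨f, ε, A, -, hε, hA⟩
  exact mainTheorem11_general hSETH le_rfl
    ⟨f 2, ε, A, hε, fun I hI _ => hA 2 I one_le_two hI⟩
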